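/- Let $\mathbb{E}^3_1$ be $\mathbb{R}^3$ with the scalar product $\langle v,w\rangle=-v_1w_1+v_2w_2+v_3w_3$, let $\wedge$ be the Lorentzian cross product, defined by $\langle v\wedge w,z\rangle=\det(v,w,z)$ for all $z$, and let $\mathbb{H}^2(-1)=\{y\in\mathbb{E}^3_1:\langle y,y\rangle=-1\}$. Let $x:M\to\mathbb{E}^3_1$ be a smooth space-like immersion of a surface (that is, the induced metric is Riemannian), oriented by a smooth unit normal vector field $N$, $\langle N,N\rangle=-1$, with shape operator $S$ given by $D_XN=-S(X)$. Suppose that $M$ lies in the time-like cone: $\langle x,x\rangle<0$ on $M$. Denote by $x^T$ the tangential part of the position vector $x$. The surface $M$ is called a generalized constant ratio (GCR) surface if, at every point, $x^T$ is a principal direction, i.e. $x^T\neq 0$ and $S(x^T)=k\,x^T$ for some real $k$. (a) $M$ is a GCR surface if and only if every point of $M$ has a neighbourhood with smooth local coordinates $(s,t)$, ranging over a product $I\times J$ of nonempty open intervals, in which $$x(s,t)=s\bigl(\cosh u(s)\,\varphi(t)+\sinh u(s)\,\varphi(t)\wedge\varphi'(t)\bigr)$$ for some smooth function $u:I\to\mathbb{R}$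 and some smooth curve $\varphi:J\to\mathbb{H}^2(-1)$ parametrized by arclength, $\langle\varphi',\varphi'\rangle=1$. (b) In this case, for every such local parametrization there are a smooth nowhere vanishing function $\theta:I\to\mathbb{R}$ with $$\coth\theta(s)=s\,u'(s),$$ a smooth unit tangent vector field $e_1$ proportional to $x^T$ and a unit normal vector field $\nu\in\{N,-N\}$ such that, on the domain of the parametrization, $$x=-s\bigl(\sinh\theta\,e_1+\cosh\theta\,\nu\bigr).$$ -/

import Mathlib

open scoped Manifold ContDiff

noncomputable section

/-- The vector space underlying Minkowski 3-space; the coordinate `0` is the time coordinate. -/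
abbrev E31 : Type := Fin 3 → ℝ

/-- The Minkowski scalar product `-v₀w₀ + v₁w₁ + v₂w₂`. -/
def mink (v w : E31) : ℝ := -(v 0 * w 0) + v 1 * w 1 + v 2 * w 2

/-- The Lorentzian cross product `v ∧ w`, see `mink_lorentzCross` and `lorentzCross_unique`. -/
def lorentzCross (v w : E31) : E31 :=
  ![-(v 1 * w 2 - v 2 * w 1), v 2 * w 0 - v 0 * w 2, v 0 * w 1 - v 1 * w 0]

/-- `⟨v ∧ w, z⟩` is the determinant of the matrix with columns `v, w, z`. -/
theorem mink_lorentzCross (v w z : E31) :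
    mink (lorentzCross v w) z = (Matrix.of ![v, w, z]).transpose.det := by
  simp [mink, lorentzCross, Matrix.det_fin_three]
  ring

theorem lorentzCross_unique (v w a : E31)
    (h : ∀ z, mink a z = (Matrix.of ![v, w, z]).transpose.det) : a = lorentzCross v w := by
  simp only [← mink_lorentzCross] at h
  have h0 := h ![1, 0, 0]
  have h1 := h ![0, 1, 0]
  have h2 := h ![0, 0, 1]
  simp [mink] at h0 h1 h2
  ext i
  fin_cases i <;> simp_all

/-- The hyperbolic plane `H²(-1) = {y | ⟨y, y⟩ = -1}`. -/
def hyperbolicPlane : Set E31 := {y | mink y y = -1}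

/-- `coth θ`, used only for `θ ≠ 0`. -/
def coth (θ : ℝ) : ℝ := Real.cosh θ / Real.sinh θ

/-- The differential at `p` of a map from a surface to Minkowski space; `surfD f p v` is the
(flat) derivative of `f` in the direction of the tangent vector `v`. -/
def surfD {M : Type*} [TopologicalSpace M] [ChartedSpace (EuclideanSpace ℝ (Fin 2)) M]
    (f : M → E31) (p : M) : TangentSpace (𝓡 2) p →L[ℝ] E31 :=
  mfderiv (𝓡 2) 𝓘(ℝ, E31) f p

/-- `x : M → E³₁` is a smooth immersion whose induced metric is Riemannian. -/
structure IsSpacelikeSurface {M : Type*} [TopologicalSpace M]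
    [ChartedSpace (EuclideanSpace ℝ (Fin 2)) M] (x : M → E31) : Prop where
  smooth : ContMDiff (𝓡 2) 𝓘(ℝ, E31) ∞ x
  immersion : ∀ p, Function.Injective (surfD x p)
  spacelike : ∀ (p : M) (v : TangentSpace (𝓡 2) p), v ≠ 0 → 0 < mink (surfD x p v) (surfD x p v)

/-- `N` is a smooth (time-like) unit normal vector field along the space-like surface `x`. -/
structure IsUnitNormal {M : Type*} [TopologicalSpace M]
    [ChartedSpace (EuclideanSpace ℝ (Fin 2)) M] (x N : M → E31) : Prop where
  smooth : ContMDiff (𝓡 2) 𝓘(ℝ, E31) ∞ N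
  unit : ∀ p, mink (N p) (N p) = -1
  normal : ∀ (p : M) (v : TangentSpace (𝓡 2) p), mink (N p) (surfD x p v) = 0

/-- The tangential part at `p` of a vector `w` of Minkowski space: the tangent vector `v` such
that `w - dx(v)` is orthogonal to the tangent plane (see `tangentialPart_spec` for existence and
`tangentialPart_unique` for uniqueness). -/
def tangentialPart {M : Type*} [TopologicalSpace M] [ChartedSpace (EuclideanSpace ℝ (Fin 2)) M]
    (x : M → E31) (p : M) (w : E31) : TangentSpace (𝓡 2) p :=
  Classical.epsilon fun v : TangentSpace (𝓡 2) p =>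
    ∀ z : TangentSpace (𝓡 2) p, mink (w - surfD x p v) (surfD x p z) = 0

theorem tangentialPart_spec {M : Type*} [TopologicalSpace M]
    [ChartedSpace (EuclideanSpace ℝ (Fin 2)) M] {x : M → E31} (hx : IsSpacelikeSurface x)
    (p : M) (w : E31) (z : TangentSpace (𝓡 2) p) :
    mink (w - surfD x p (tangentialPart x p w)) (surfD x p z) = 0 := by
  have key : ∃ v : TangentSpace (𝓡 2) p,
      ∀ z : TangentSpace (𝓡 2) p, mink (w - surfD x p v) (surfD x p z) = 0 := by
    let V := EuclideanSpace ℝ (Fin 2)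
    let A : V →ₗ[ℝ] E31 := (surfD x p).toLinearMap
    have hA : ∀ v : V, v ≠ 0 → 0 < mink (A v) (A v) := hx.spacelike p
    let R : E31 →ₗ[ℝ] Module.Dual ℝ V := LinearMap.mk₂ ℝ (fun y z => mink y (A z))
      (by intros; simp [mink]; ring) (by intros; simp [mink]; ring)
      (by intros; simp [mink]; ring) (by intros; simp [mink]; ring)
    have hR : ∀ y z, R y z = mink y (A z) := fun _ _ => rfl
    have inj : Function.Injective (R ∘ₗ A) := by
      rw [← LinearMap.ker_eq_bot, LinearMap.ker_eq_bot']
      intro v hv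
      by_contra hne
      have h1 := hA v hne
      have h2 : R (A v) v = 0 := by
        have := congrArg (fun f : Module.Dual ℝ V => f v) hv
        simpa using this
      rw [hR] at h2
      exact h1.ne' h2
    have surj : Function.Surjective (R ∘ₗ A) :=
      (LinearMap.injective_iff_surjective_of_finrank_eq_finrank
        (Subspace.dual_finrank_eq (K := ℝ) (V := V)).symm).1 inj
    obtain ⟨v, hv⟩ := surj (R w)
    refine ⟨v, fun z => ?_⟩
    have h3 : mink (A v) (A z) = mink w (A z) := congrArg (fun f : Module.Dual ℝ V => f z) hv
    change mink (w - A v) (A z) = 0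
    simp only [mink, Pi.sub_apply] at h3 ⊢
    linarith
  exact Classical.epsilon_spec key z

theorem tangentialPart_unique {M : Type*} [TopologicalSpace M]
    [ChartedSpace (EuclideanSpace ℝ (Fin 2)) M] {x : M → E31} (hx : IsSpacelikeSurface x)
    (p : M) (w : E31) (v : TangentSpace (𝓡 2) p)
    (hv : ∀ z, mink (w - surfD x p v) (surfD x p z) = 0) : tangentialPart x p w = v := by
  by_contra hne
  have h1 := hx.spacelike p (tangentialPart x p w - v) (sub_ne_zero.2 hne)
  have h2 := tangentialPart_spec hx p w (tangentialPart x p w - v)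
  have h3 := hv (tangentialPart x p w - v)
  rw [map_sub] at h1 h2 h3
  simp only [mink, Pi.sub_apply] at h1 h2 h3
  linarith

/-- The shape operator `S`, given by the Weingarten formula `D_v N = -S(v)` (the derivative of a
unit normal field is tangential). -/
def shapeOperator {M : Type*} [TopologicalSpace M] [ChartedSpace (EuclideanSpace ℝ (Fin 2)) M]
    (x N : M → E31) (p : M) (v : TangentSpace (𝓡 2) p) : TangentSpace (𝓡 2) p :=
  -tangentialPart x p (surfD N p v)

/-- `v` spans a principal direction at `p`: it is an eigenvector of the shape operator. -/
def IsPrincipalDirection {M : Type*} [TopologicalSpace M]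
    [ChartedSpace (EuclideanSpace ℝ (Fin 2)) M] (x N : M → E31) (p : M)
    (v : TangentSpace (𝓡 2) p) : Prop :=
  v ≠ 0 ∧ ∃ k : ℝ, shapeOperator x N p v = k • v

/-- Generalized constant ratio surface: at every point the tangential part `x^T` of the position
vector is a principal direction. -/
def IsGCR {M : Type*} [TopologicalSpace M] [ChartedSpace (EuclideanSpace ℝ (Fin 2)) M]
    (x N : M → E31) : Prop :=
  ∀ p, IsPrincipalDirection x N p (tangentialPart x p (x p))

/-- `φ` is, on `J`, a smooth curve lying on `H²(-1)` and parametrized by arclength. -/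
structure IsArclengthCurve (J : Set ℝ) (φ : ℝ → E31) : Prop where
  smooth : ContDiffOn ℝ ∞ φ J
  mem : ∀ t ∈ J, φ t ∈ hyperbolicPlane
  unit_speed : ∀ t ∈ J, mink (deriv φ t) (deriv φ t) = 1

/-- The local coordinate system `(s, t) = (e q 0, e q 1)` of the surface has as its range the
rectangle `I × J` of two nonempty open intervals, and in it the surface is
`x(s, t) = s (cosh u(s) φ(t) + sinh u(s) φ(t) ∧ φ'(t))`
with `u` smooth on `I` and `φ` an arclength curve in `H²(-1)` defined on `J`. -/
structure IsGCRParametrization {M : Type*} [TopologicalSpace M]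
    [ChartedSpace (EuclideanSpace ℝ (Fin 2)) M] [IsManifold (𝓡 2) ∞ M] (x : M → E31)
    (e : OpenPartialHomeomorph M (EuclideanSpace ℝ (Fin 2))) (I J : Set ℝ)
    (u : ℝ → ℝ) (φ : ℝ → E31) : Prop where
  chart : e ∈ IsManifold.maximalAtlas (𝓡 2) ∞ M
  open_I : IsOpen I
  interval_I : I.OrdConnected
  nonempty_I : I.Nonempty
  open_J : IsOpen J
  interval_J : J.OrdConnected
  nonempty_J : J.Nonempty
  target : e.target = {y | y 0 ∈ I ∧ y 1 ∈ J}
  smooth_u : ContDiffOn ℝ ∞ u I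
  curve : IsArclengthCurve J φ
  eq : ∀ q ∈ e.source, x q = e q 0 • (Real.cosh (u (e q 0)) • φ (e q 1) +
    Real.sinh (u (e q 0)) • lorentzCross (φ (e q 1)) (deriv φ (e q 1)))

/-- On the domain of the coordinate system `(s, t) = (e q 0, e q 1)` the position vector is
`x = -s (sinh θ e₁ + cosh θ ν)`, where `θ = θ(s)` is smooth with `coth θ = s u'(s)` and `e₁` is a
smooth unit tangent vector field along `x^T`. -/
def HasGCRDecomposition {M : Type*} [TopologicalSpace M]
    [ChartedSpace (EuclideanSpace ℝ (Fin 2)) M] (x ν : M → E31)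
    (e : OpenPartialHomeomorph M (EuclideanSpace ℝ (Fin 2))) (I : Set ℝ) (u : ℝ → ℝ) : Prop :=
  ∃ (θ : ℝ → ℝ) (e₁ : ∀ q : M, TangentSpace (𝓡 2) q),
    ContDiffOn ℝ ∞ θ I ∧
    (∀ s ∈ I, θ s ≠ 0 ∧ coth (θ s) = s * deriv u s) ∧
    ContMDiffOn (𝓡 2) 𝓘(ℝ, E31) ∞ (fun q => surfD x q (e₁ q)) e.source ∧
    ∀ q ∈ e.source,
      mink (surfD x q (e₁ q)) (surfD x q (e₁ q)) = 1 ∧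
      (∃ c : ℝ, tangentialPart x q (x q) = c • e₁ q) ∧
      x q = -(e q 0) • (Real.sinh (θ (e q 0)) • surfD x q (e₁ q) +
        Real.cosh (θ (e q 0)) • ν q)

end

/-!
Everything is computed in a chart, where the surface is a map `f` from an open set of the plane to
Minkowski space and `n` is its unit normal (`IsLocalSurface`, `isPrincipalDirection_iff`).

Suppose first that `x^T` is a principal direction. Let `s = √(-⟨x, x⟩)` and `μ = ⟨x, N⟩`. The
symmetry of the second fundamental form gives `dμ = k s ds` (`IsLocalSurface.fderiv_support`), so
`μ` is locally a function of `s`; moreover `|x^T|² = μ² - s² > 0`, so `ds ≠ 0`. Let `A = x / s`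
and let `B` complete `A` to an orthonormal frame of the plane spanned by `x` and `N`. Then
`⟨dA, B⟩ = d(u(s))` for an antiderivative `u` of a function of `s`. If the frame is turned by the
angle `u(s)`, the derivative of its time-like vector `Φ = cosh u A - sinh u B` is orthogonal to
both vectors of the pair (`IsFramePair.mink_fderiv_rotate`), hence is a multiple `λ C` of the
third frame vector `C`, where `λ` is a 1-form. So `Φ` has rank one and is an arclength curve
`φ(t)` with `dt = λ`. This `t` is constructed without integrating a vector field: the function
`⟨Φ, C(p)⟩` is a coordinate near `p` through which `Φ` factors, and `t` is the arclength of the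
resulting curve (`IsFramePair.exists_arclength_chart`). Solving for `x = s A` gives the
parametrization (`IsLocalSurface.exists_gcr_chart`).

Conversely, let `A = cosh u φ + sinh u φ ∧ φ'` and `B = sinh u φ + cosh u φ ∧ φ'`. Then `x = s A`,
`∂_s x = A + s u' B`, and `∂_t x` is a multiple of `φ'`. So `x^T` is a multiple of `∂_s x`, and
`N` is orthogonal to `φ'(t)`; differentiating this along an `s`-line shows that `∂_s N` is a
multiple of `∂_s x` (`IsExplicitGCR.isPrincipalPosition`). The surface is space-like, so `(s u')²
> 1` and `θ = artanh (1 / (s u'))` is defined. The decomposition of `x` then holds with `e₁ = sinh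
θ ∂_s x = sinh θ A + cosh θ B` and `ν = -(cosh θ A + sinh θ B)`, and the sign relating `ν` to `N`
is constant because the coordinate domain is connected (`IsExplicitGCR.exists_decomposition`).
-/

/-! ### The Minkowski scalar product and the Lorentzian cross product -/

theorem mink_comm (v w : E31) : mink v w = mink w v := by
  simp only [mink]; ring

@[simp] theorem mink_add_left (v v' w : E31) : mink (v + v') w = mink v w + mink v' w := by
  simp only [mink, Pi.add_apply]; ring

@[simp] theorem mink_add_right (v w w' : E31) : mink v (w + w') = mink v w + mink v w' := by
  simp only [mink, Pi.add_apply]; ring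

@[simp] theorem mink_sub_left (v v' w : E31) : mink (v - v') w = mink v w - mink v' w := by
  simp only [mink, Pi.sub_apply]; ring

@[simp] theorem mink_sub_right (v w w' : E31) : mink v (w - w') = mink v w - mink v w' := by
  simp only [mink, Pi.sub_apply]; ring

@[simp] theorem mink_smul_left (c : ℝ) (v w : E31) : mink (c • v) w = c * mink v w := by
  simp only [mink, Pi.smul_apply, smul_eq_mul]; ring

@[simp] theorem mink_smul_right (c : ℝ) (v w : E31) : mink v (c • w) = c * mink v w := by
  simp only [mink, Pi.smul_apply, smul_eq_mul]; ring

@[simp] theorem mink_neg_left (v w : E31) : mink (-v) w = -mink v w := by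
  simp only [mink, Pi.neg_apply]; ring

@[simp] theorem mink_neg_right (v w : E31) : mink v (-w) = -mink v w := by
  simp only [mink, Pi.neg_apply]; ring

@[simp] theorem mink_zero_left (w : E31) : mink 0 w = 0 := by simp [mink]

@[simp] theorem mink_zero_right (w : E31) : mink w 0 = 0 := by simp [mink]

/-- The Minkowski scalar product is nondegenerate. -/
theorem eq_zero_of_mink_eq_zero {w : E31} (h : ∀ z, mink w z = 0) : w = 0 := by
  have h0 := h ![1, 0, 0]
  have h1 := h ![0, 1, 0]
  have h2 := h ![0, 0, 1]
  simp [mink] at h0 h1 h2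
  ext i
  fin_cases i <;> simp_all

/-- The Minkowski scalar product as a linear map in both arguments. -/
noncomputable def minkLM : E31 →ₗ[ℝ] E31 →ₗ[ℝ] ℝ :=
  LinearMap.mk₂ ℝ mink mink_add_left mink_smul_left mink_add_right mink_smul_right

/-- The Minkowski scalar product as a continuous bilinear map. -/
noncomputable def minkCLM : E31 →L[ℝ] E31 →L[ℝ] ℝ := minkLM.toContinuousBilinearMap

theorem minkCLM_apply (v w : E31) : minkCLM v w = mink v w := rfl

/-- The Lorentzian cross product as a continuous bilinear map. -/
noncomputable def crossCLM : E31 →L[ℝ] E31 →L[ℝ] E31 :=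
  (LinearMap.mk₂ ℝ lorentzCross
    (by intros; ext i; fin_cases i <;> simp [lorentzCross] <;> ring)
    (by intros; ext i; fin_cases i <;> simp [lorentzCross] <;> ring)
    (by intros; ext i; fin_cases i <;> simp [lorentzCross] <;> ring)
    (by intros; ext i; fin_cases i <;> simp [lorentzCross] <;> ring)
      : E31 →ₗ[ℝ] E31 →ₗ[ℝ] E31).toContinuousBilinearMap

@[simp] theorem mink_cross_self_left (v w : E31) : mink v (lorentzCross v w) = 0 := by
  simp [mink, lorentzCross]; ring

@[simp] theorem mink_cross_self_right (v w : E31) : mink w (lorentzCross v w) = 0 := by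
  simp [mink, lorentzCross]; ring

theorem mink_cross_cross (v w : E31) :
    mink (lorentzCross v w) (lorentzCross v w) = mink v w ^ 2 - mink v v * mink w w := by
  simp [mink, lorentzCross]; ring

theorem lorentzCross_lorentzCross (u v w : E31) :
    lorentzCross u (lorentzCross v w) = mink u v • w - mink u w • v := by
  ext i
  fin_cases i <;> simp [mink, lorentzCross] <;> ring

/-- Three pairwise orthogonal vectors, none of them null, determine a vector by its scalar
products with them. -/
theorem eq_zero_of_mink_frame {a b c w : E31} (ha : mink a a ≠ 0) (hb : mink b b ≠ 0)
    (hc : mink c c ≠ 0) (hab : mink a b = 0) (hac : mink a c = 0) (hbc : mink b c = 0)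
    (hwa : mink w a = 0) (hwb : mink w b = 0) (hwc : mink w c = 0) : w = 0 := by
  have hba := (mink_comm b a).trans hab
  have hca := (mink_comm c a).trans hac
  have hcb := (mink_comm c b).trans hbc
  have hli : LinearIndependent ℝ ![a, b, c] := by
    rw [Fintype.linearIndependent_iff]
    intro g hg
    simp only [Fin.sum_univ_three, Matrix.cons_val_zero, Matrix.cons_val_one,
      Matrix.cons_val_two] at hg
    have e0 := congrArg (mink a) hg
    have e1 := congrArg (mink b) hg
    have e2 := congrArg (mink c) hg
    simp [hab, hac, hbc, hba, hca, hcb, ha, hb, hc] at e0 e1 e2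
    intro i
    fin_cases i <;> simpa
  have hspan := hli.span_eq_top_of_card_eq_finrank (by simp)
  refine eq_zero_of_mink_eq_zero fun z => ?_
  have hz : z ∈ Submodule.span ℝ (Set.range ![a, b, c]) := hspan ▸ Submodule.mem_top
  induction hz using Submodule.span_induction with
  | mem y hy =>
    obtain ⟨i, rfl⟩ := hy
    fin_cases i <;> simpa
  | zero => simp
  | add y z _ _ hy hz => simp [hy, hz]
  | smul r y _ hy => simp [hy]

/-! ### Derivatives of scalar and cross products -/

section Calculus

variable {X : Type*} [NormedAddCommGroup X] [NormedSpace ℝ X]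

theorem ContDiffOn.mink {F G : X → E31} {s : Set X} (hF : ContDiffOn ℝ ∞ F s)
    (hG : ContDiffOn ℝ ∞ G s) : ContDiffOn ℝ ∞ (fun y => mink (F y) (G y)) s :=
  (minkCLM.contDiff.comp_contDiffOn hF).clm_apply hG

theorem ContDiffOn.lorentzCross {F G : X → E31} {s : Set X} (hF : ContDiffOn ℝ ∞ F s)
    (hG : ContDiffOn ℝ ∞ G s) : ContDiffOn ℝ ∞ (fun y => lorentzCross (F y) (G y)) s :=
  (crossCLM.contDiff.comp_contDiffOn hF).clm_apply hG

theorem DifferentiableAt.mink {F G : X → E31} {y : X} (hF : DifferentiableAt ℝ F y)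
    (hG : DifferentiableAt ℝ G y) : DifferentiableAt ℝ (fun y => mink (F y) (G y)) y :=
  (minkCLM.hasFDerivAt_of_bilinear hF.hasFDerivAt hG.hasFDerivAt).differentiableAt

theorem fderiv_mink {F G : X → E31} {y : X} (hF : DifferentiableAt ℝ F y)
    (hG : DifferentiableAt ℝ G y) (v : X) :
    fderiv ℝ (fun y => mink (F y) (G y)) y v =
      mink (fderiv ℝ F y v) (G y) + mink (F y) (fderiv ℝ G y v) := by
  have h := minkCLM.hasFDerivAt_of_bilinear hF.hasFDerivAt hG.hasFDerivAt
  rw [show (fun y => mink (F y) (G y)) = fun y => minkCLM (F y) (G y) from rfl, h.fderiv]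
  simp [minkCLM_apply, add_comm]

/-- The product rule for a scalar product that is constant near a point. -/
theorem mink_fderiv_add_eq_zero {F G : X → E31} {y : X} {c : ℝ} {s : Set X} (hs : IsOpen s)
    (hy : y ∈ s) (hF : DifferentiableAt ℝ F y) (hG : DifferentiableAt ℝ G y)
    (h : ∀ z ∈ s, mink (F z) (G z) = c) (v : X) :
    mink (fderiv ℝ F y v) (G y) + mink (F y) (fderiv ℝ G y v) = 0 := by
  rw [← fderiv_mink hF hG]
  have h1 : (fun y => mink (F y) (G y)) =ᶠ[nhds y] fun _ => c := by
    filter_upwards [hs.mem_nhds hy] with z hz using h z hz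
  rw [h1.fderiv_eq]
  simp

/-- The derivative of a vector field of constant square is orthogonal to it. -/
theorem mink_fderiv_self {F : X → E31} {y : X} {c : ℝ} {s : Set X} (hs : IsOpen s)
    (hy : y ∈ s) (hF : DifferentiableAt ℝ F y) (h : ∀ z ∈ s, mink (F z) (F z) = c) (v : X) :
    mink (fderiv ℝ F y v) (F y) = 0 := by
  have := mink_fderiv_add_eq_zero hs hy hF hF h v
  rw [mink_comm (F y)] at this
  linarith

end Calculus

theorem HasDerivAt.mink {F G : ℝ → E31} {F' G' : E31} {t : ℝ} (hF : HasDerivAt F F' t)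
    (hG : HasDerivAt G G' t) :
    HasDerivAt (fun t => mink (F t) (G t)) (mink F' (G t) + mink (F t) G') t := by
  have h := (minkCLM.hasFDerivAt_of_bilinear hF.hasFDerivAt hG.hasFDerivAt).hasDerivAt
  simpa [minkCLM_apply, add_comm] using h

/-- The product rule along a curve, for a scalar product that is constant near a point. -/
theorem mink_deriv_add_eq_zero {F G : ℝ → E31} {t c : ℝ} {s : Set ℝ} (hs : IsOpen s)
    (ht : t ∈ s) (hF : DifferentiableAt ℝ F t) (hG : DifferentiableAt ℝ G t)
    (h : ∀ z ∈ s, mink (F z) (G z) = c) :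
    mink (deriv F t) (G t) + mink (F t) (deriv G t) = 0 := by
  have h1 : (fun y => mink (F y) (G y)) =ᶠ[nhds t] fun _ => c := by
    filter_upwards [hs.mem_nhds ht] with z hz using h z hz
  rw [← (hF.hasDerivAt.mink hG.hasDerivAt).deriv, h1.deriv_eq]
  simp

/-- A smooth function on an open interval has a smooth antiderivative. -/
theorem exists_smooth_antideriv {I : Set ℝ} (hI : IsOpen I) (hc : I.OrdConnected) {g : ℝ → ℝ}
    (hg : ContDiffOn ℝ ∞ g I) {a : ℝ} (ha : a ∈ I) :
    ∃ h : ℝ → ℝ, ContDiffOn ℝ ∞ h I ∧ h a = 0 ∧ ∀ t ∈ I, HasDerivAt h (g t) t := by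
  have hd : ∀ t ∈ I, HasDerivAt (fun t => ∫ r in a..t, g r) (g t) t := by
    intro t ht
    have hcont : ContinuousOn g (Set.uIcc a t) := hg.continuousOn.mono (hc.uIcc_subset ha ht)
    refine intervalIntegral.integral_hasDerivAt_right hcont.intervalIntegrable ?_ ?_
    · exact hg.continuousOn.stronglyMeasurableAtFilter hI t ht
    · exact hg.continuousOn.continuousAt (hI.mem_nhds ht)
  refine ⟨fun t => ∫ r in a..t, g r, ?_, by simp, hd⟩
  rw [contDiffOn_infty_iff_deriv_of_isOpen hI]
  exact ⟨fun t ht => (hd t ht).differentiableAt.differentiableWithinAt,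
    hg.congr fun t ht => (hd t ht).deriv⟩

/-! ### Box-shaped charts of the parameter plane -/

/-- The plane in which charts of a surface take their values. -/
abbrev E2 : Type := EuclideanSpace ℝ (Fin 2)

/-- The `i`-th coordinate vector of the plane. -/
noncomputable abbrev coordVec (i : Fin 2) : E2 := EuclideanSpace.single i 1

/-- A product of two nonempty open intervals in the plane, with its two factors. -/
structure IsBox (R : Set E2) (K : Fin 2 → Set ℝ) : Prop where
  eq : R = {y | ∀ i, y i ∈ K i}
  isOpen_side : ∀ i, IsOpen (K i)
  ordConnected : ∀ i, (K i).OrdConnected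
  nonempty : ∀ i, (K i).Nonempty

/-- The `i`-th coordinate of the plane, as a continuous linear functional. -/
noncomputable abbrev coordCLM (i : Fin 2) : E2 →L[ℝ] ℝ := EuclideanSpace.proj i

/-- The chain rule for a curve composed with a real-valued function. -/
theorem fderiv_eq_smul_deriv_comp {F : Type*} [NormedAddCommGroup F] [NormedSpace ℝ F] {H : E2 → F}
    {b : E2 → ℝ} {η : ℝ → F} {U : Set E2} (hU : IsOpen U) {y : E2} (hy : y ∈ U)
    (hη : DifferentiableAt ℝ η (b y)) (hb : DifferentiableAt ℝ b y) (h : ∀ z ∈ U, H z = η (b z))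
    (v : E2) : fderiv ℝ H y v = fderiv ℝ b y v • deriv η (b y) := by
  have h1 := hη.hasDerivAt.hasFDerivAt.comp y hb.hasFDerivAt
  have h2 : H =ᶠ[nhds y] η ∘ b := by
    filter_upwards [hU.mem_nhds hy] with z hz using h z hz
  rw [(h1.congr_of_eventuallyEq h2).fderiv]
  simp

theorem contDiff_coord (i : Fin 2) : ContDiff ℝ ∞ fun y : E2 => y i :=
  (coordCLM i).contDiff

theorem hasFDerivAt_coord (i : Fin 2) (y : E2) :
    HasFDerivAt (fun y : E2 => y i) (coordCLM i) y :=
  (coordCLM i).hasFDerivAt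

namespace IsBox

variable {R : Set E2} {K : Fin 2 → Set ℝ}

theorem mem_iff (h : IsBox R K) {y : E2} : y ∈ R ↔ ∀ i, y i ∈ K i := by
  rw [h.eq]; rfl

theorem isOpen (h : IsBox R K) : IsOpen R := by
  rw [h.eq, Set.ofPred_forall]
  exact isOpen_iInter_of_finite fun i => (h.isOpen_side i).preimage (contDiff_coord i).continuous

theorem convex (h : IsBox R K) : Convex ℝ R := by
  rw [h.eq, Set.ofPred_forall]
  exact convex_iInter fun i => (h.ordConnected i).convex.linear_preimage
    (coordCLM i).toLinearMap

theorem exists_mem (h : IsBox R K) : ∃ y, y ∈ R := by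
  choose a ha using h.nonempty
  exact ⟨WithLp.toLp 2 a, h.mem_iff.2 ha⟩

/-- Moving one coordinate inside its interval does not leave the box. -/
theorem slide_mem (h : IsBox R K) {y : E2} (hy : y ∈ R) {j : Fin 2} {r : ℝ} (hr : r ∈ K j) :
    y + (r - y j) • coordVec j ∈ R := by
  rw [h.mem_iff] at hy ⊢
  intro i
  rcases eq_or_ne i j with rfl | hij
  · simpa using hr
  · simpa [hij] using hy i

/-- A function on a box whose derivative kills the vectors with vanishing `j`-th component
depends on the `j`-th coordinate only. -/
theorem eq_of_coord_eq (h : IsBox R K) {F : Type*} [NormedAddCommGroup F] [NormedSpace ℝ F]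
    {H : E2 → F} (hH : DifferentiableOn ℝ H R) {j : Fin 2}
    (hker : ∀ y ∈ R, ∀ v : E2, v j = 0 → fderiv ℝ H y v = 0) {y y' : E2} (hy : y ∈ R)
    (hy' : y' ∈ R) (hj : y j = y' j) : H y = H y' := by
  have hmem : ∀ t ∈ Set.Icc (0 : ℝ) 1, y' + t • (y - y') ∈ R := fun t ht =>
    h.convex.add_smul_sub_mem hy' hy ht
  have hd : ∀ t ∈ Set.Icc (0 : ℝ) 1, HasDerivAt (fun t : ℝ => H (y' + t • (y - y'))) 0 t := by
    intro t ht
    have h1 := (hH.differentiableAt (h.isOpen.mem_nhds (hmem t ht))).hasFDerivAt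
    have h2 : HasDerivAt (fun t : ℝ => y' + t • (y - y')) (y - y') t := by
      simpa using ((hasDerivAt_id t).smul_const (y - y')).const_add y'
    have h3 := h1.comp_hasDerivAt t h2
    rwa [hker _ (hmem t ht) (y - y') (by simp [hj])] at h3
  have := constant_of_derivWithin_zero
    (fun t ht => (hd t ht).differentiableAt.differentiableWithinAt)
    (fun t ht => (hd t ⟨ht.1, ht.2.le⟩).hasDerivWithinAt.derivWithin
      (uniqueDiffOn_Icc one_pos t ⟨ht.1, ht.2.le⟩)) 1 ⟨zero_le_one, le_rfl⟩
  simpa using this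

end IsBox

/-- Partial derivatives: the differential of `F` on a coordinate vector is the derivative of `F`
along the corresponding coordinate line. -/
theorem fderiv_coordVec {F : Type*} [NormedAddCommGroup F] [NormedSpace ℝ F] {H : E2 → F} {y : E2}
    (hH : DifferentiableAt ℝ H y) {j : Fin 2} {c : ℝ → F} {c' : F} (hc : HasDerivAt c c' (y j))
    (h : ∀ᶠ r in nhds (y j), H (y + (r - y j) • coordVec j) = c r) :
    fderiv ℝ H y (coordVec j) = c' := by
  have h2 : HasDerivAt (fun r : ℝ => y + (r - y j) • coordVec j) (coordVec j) (y j) := by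
    simpa using (((hasDerivAt_id (y j)).sub_const (y j)).smul_const (coordVec j)).const_add y
  have h1 : HasFDerivAt H (fderiv ℝ H y) (y + (y j - y j) • coordVec j) := by
    simpa using hH.hasFDerivAt
  exact (h1.comp_hasDerivAt (y j) h2).unique (hc.congr_of_eventuallyEq h)

/-- Every point of an open set of the plane has a box around it inside this set. -/
theorem exists_isBox_subset {U : Set E2} (hU : IsOpen U) {p : E2} (hp : p ∈ U) :
    ∃ R K, IsBox R K ∧ p ∈ R ∧ R ⊆ U := by
  have h1 : IsOpen ((fun c : Fin 2 → ℝ => (WithLp.toLp 2 c : E2)) ⁻¹' U) :=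
    hU.preimage (PiLp.continuous_toLp 2 _)
  obtain ⟨ε, hε, hsub⟩ := Metric.isOpen_iff.1 h1 (WithLp.ofLp p) (by simpa using hp)
  refine ⟨{y | ∀ i, y i ∈ Set.Ioo (p i - ε) (p i + ε)}, fun i => Set.Ioo (p i - ε) (p i + ε),
    ⟨rfl, fun i => isOpen_Ioo, fun i => Set.ordConnected_Ioo, fun i => ⟨p i, by simp [hε]⟩⟩,
    fun i => by simp [hε], fun y hy => ?_⟩
  have : WithLp.ofLp y ∈ Metric.ball (WithLp.ofLp p) ε := by
    rw [Metric.mem_ball, dist_pi_lt_iff hε]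
    intro i
    rw [← Metric.mem_ball, Real.ball_eq_Ioo]
    exact hy i
  simpa using hsub this

/-- A smooth coordinate system of an open subset of the plane with values in a box. -/
structure IsBoxChart (g : OpenPartialHomeomorph E2 E2) (K : Fin 2 → Set ℝ) : Prop where
  box : IsBox g.target K
  smooth : ContDiffOn ℝ ∞ g g.source
  smooth_symm : ContDiffOn ℝ ∞ g.symm g.target

namespace IsBoxChart

variable {g : OpenPartialHomeomorph E2 E2} {K : Fin 2 → Set ℝ}

theorem smooth_coord (h : IsBoxChart g K) (i : Fin 2) :
    ContDiffOn ℝ ∞ (fun y => g y i) g.source :=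
  (contDiff_coord i).comp_contDiffOn h.smooth

theorem coord_mem (h : IsBoxChart g K) {y : E2} (hy : y ∈ g.source) (i : Fin 2) : g y i ∈ K i :=
  h.box.mem_iff.1 (g.map_source hy) i

/-- The coordinate functions of a chart, transported by the inverse of the chart, are the
standard ones. -/
theorem fderiv_coord_symm (h : IsBoxChart g K) {z : E2} (hz : z ∈ g.target) (i : Fin 2) (v : E2) :
    fderiv ℝ (fun y => g y i) (g.symm z) (fderiv ℝ g.symm z v) = v i := by
  have h1 : DifferentiableAt ℝ (fun y => g y i) (g.symm z) :=
    ((h.smooth_coord i).contDiffAt (g.open_source.mem_nhds (g.map_target hz))).differentiableAt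
      (by simp)
  have h2 : DifferentiableAt ℝ g.symm z :=
    (h.smooth_symm.contDiffAt (g.open_target.mem_nhds hz)).differentiableAt (by simp)
  have h3 := h1.hasFDerivAt.comp z h2.hasFDerivAt
  have h4 : (fun y => g y i) ∘ g.symm =ᶠ[nhds z] fun y => y i := by
    filter_upwards [g.open_target.mem_nhds hz] with y hy
    simp [g.right_inv hy]
  have h5 := h3.unique ((hasFDerivAt_coord i z).congr_of_eventuallyEq h4)
  simpa using congrArg (fun l => l v) h5

/-- If `dF` vanishes wherever the differential of the `j`-th coordinate function does, then `F` is
a smooth function of this coordinate. -/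
theorem exists_eq_comp (h : IsBoxChart g K) {F : Type*} [NormedAddCommGroup F] [NormedSpace ℝ F]
    {H : E2 → F} (hH : ContDiffOn ℝ ∞ H g.source) {j : Fin 2}
    (hker : ∀ y ∈ g.source, ∀ v : E2,
      fderiv ℝ (fun y => g y j) y v = 0 → fderiv ℝ H y v = 0) :
    ∃ η : ℝ → F, ContDiffOn ℝ ∞ η (K j) ∧ ∀ y ∈ g.source, H y = η (g y j) := by
  obtain ⟨b, hb⟩ := h.box.exists_mem
  have hG : ContDiffOn ℝ ∞ (H ∘ g.symm) g.target :=
    hH.comp h.smooth_symm fun z hz => g.map_target hz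
  refine ⟨fun r => (H ∘ g.symm) (b + (r - b j) • coordVec j), ?_, fun y hy => ?_⟩
  · refine hG.comp (ContDiff.contDiffOn (by fun_prop)) fun r hr => h.box.slide_mem hb hr
  · have h1 : (H ∘ g.symm) (g y) = (H ∘ g.symm) (b + (g y j - b j) • coordVec j) := by
      refine h.box.eq_of_coord_eq (j := j) (hG.differentiableOn (by simp)) ?_
        (g.map_source hy) (h.box.slide_mem hb (h.coord_mem hy j)) (by simp)
      intro z hz v hv
      have h2 : DifferentiableAt ℝ H (g.symm z) :=
        (hH.contDiffAt (g.open_source.mem_nhds (g.map_target hz))).differentiableAt (by simp)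
      have h3 : DifferentiableAt ℝ g.symm z :=
        (h.smooth_symm.contDiffAt (g.open_target.mem_nhds hz)).differentiableAt (by simp)
      rw [fderiv_comp z h2 h3]
      exact hker _ (g.map_target hz) _ ((h.fderiv_coord_symm hz j v).trans hv)
    simpa [g.left_inv hy] using h1

/-- Every coordinate function of a chart is a submersion. -/
theorem exists_fderiv_coord_eq_one (h : IsBoxChart g K) {y : E2} (hy : y ∈ g.source)
    (j : Fin 2) : ∃ v : E2, fderiv ℝ (fun y => g y j) y v = 1 := by
  have h1 := h.fderiv_coord_symm (g.map_source hy) j (coordVec j)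
  rw [g.left_inv hy] at h1
  exact ⟨_, h1.trans (by simp)⟩

/-- The values of a coordinate function fill its whole interval. -/
theorem exists_coord_eq (h : IsBoxChart g K) {j : Fin 2} {r : ℝ} (hr : r ∈ K j) :
    ∃ y ∈ g.source, g y j = r := by
  obtain ⟨b, hb⟩ := h.box.exists_mem
  have h1 := h.box.slide_mem hb hr
  refine ⟨_, g.map_target h1, ?_⟩
  rw [g.right_inv h1]
  simp

end IsBoxChart

/-- Two smooth functions whose differentials at `p` are independent are the coordinate functions
of a chart around `p`. -/
theorem exists_isBoxChart {U : Set E2} (hU : IsOpen U) {p : E2} (hp : p ∈ U) {a : Fin 2 → E2 → ℝ}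
    (ha : ∀ i, ContDiffOn ℝ ∞ (a i) U)
    (hind : ∀ v : E2, (∀ i, fderiv ℝ (a i) p v = 0) → v = 0) :
    ∃ g K, IsBoxChart g K ∧ p ∈ g.source ∧ g.source ⊆ U ∧ ∀ y i, g y i = a i y := by
  set G : E2 → E2 := fun y => WithLp.toLp 2 fun i => a i y with hGdef
  have hG : ContDiffOn ℝ ∞ G U := by
    rw [contDiffOn_euclidean]
    exact ha
  have hGp := hG.contDiffAt (hU.mem_nhds hp)
  have hcomp : ∀ v i, fderiv ℝ G p v i = fderiv ℝ (a i) p v := by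
    intro v i
    have h1 := (hasFDerivAt_coord i (G p)).comp p (hGp.differentiableAt (by simp)).hasFDerivAt
    have h2 : HasFDerivAt (a i) _ p := h1
    rw [h2.fderiv]
    rfl
  have hinj : Function.Injective (fderiv ℝ G p) := by
    rw [injective_iff_map_eq_zero]
    intro v hv
    exact hind v fun i => by rw [← hcomp, hv]; rfl
  let L : E2 ≃L[ℝ] E2 :=
    (LinearEquiv.ofInjectiveEndo (fderiv ℝ G p).toLinearMap hinj).toContinuousLinearEquiv
  have hL : (L : E2 →L[ℝ] E2) = fderiv ℝ G p := by ext1 v; rfl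
  have hGd : HasFDerivAt G (L : E2 →L[ℝ] E2) p :=
    hL ▸ (hGp.differentiableAt (by simp)).hasFDerivAt
  let g₀ := hGp.toOpenPartialHomeomorph G hGd (by simp)
  have hg₀ : ∀ y, g₀ y = G y := fun y => rfl
  have hpg₀ : p ∈ g₀.source := hGp.mem_toOpenPartialHomeomorph_source hGd (by simp)
  -- the differential stays invertible near `p`, which makes the inverse smooth on an open set
  have hopen : IsOpen (U ∩ fderiv ℝ G ⁻¹' Set.range ((↑) : (E2 ≃L[ℝ] E2) → E2 →L[ℝ] E2)) :=
    (hG.continuousOn_fderiv_of_isOpen hU (by simp)).isOpen_inter_preimage hU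
      ContinuousLinearEquiv.isOpen
  set g₁ := g₀.restrOpen _ hopen with hg₁
  have hs₁ : g₁.source = g₀.source ∩ _ := g₀.restrOpen_source _ hopen
  have hpg₁ : p ∈ g₁.source := by
    rw [hs₁]
    exact ⟨hpg₀, hp, L, hL⟩
  obtain ⟨R, K, hR, hpR, hRsub⟩ := exists_isBox_subset g₁.open_target (g₁.map_source hpg₁)
  set g := (g₁.symm.restrOpen R hR.isOpen).symm with hg
  have ht : g.target = R := by
    change (g₁.symm.restrOpen R hR.isOpen).source = R
    rw [OpenPartialHomeomorph.restrOpen_source]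
    exact Set.inter_eq_right.2 hRsub
  have hgG : ∀ y, g y = G y := fun y => rfl
  have hsub : g.source ⊆ g₁.source := by
    intro y hy
    have h1 : g y ∈ g₁.target := hRsub (ht ▸ g.map_source hy)
    have h2 : g₁.symm (g y) = y := g.left_inv hy
    exact h2 ▸ g₁.map_target h1
  have hsubU : g.source ⊆ U := fun y hy => by
    have := hsub hy
    rw [hs₁] at this
    exact this.2.1
  refine ⟨g, K, ⟨ht ▸ hR, hG.mono hsubU, fun z hz => ContDiffAt.contDiffWithinAt ?_⟩, ?_, hsubU,
    fun y i => rfl⟩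
  · have h1 := hsub (g.map_target hz)
    rw [hs₁] at h1
    obtain ⟨L', hL'⟩ := h1.2.2
    have h2 : ContDiffAt ℝ ∞ G (g.symm z) := hG.contDiffAt (hU.mem_nhds h1.2.1)
    refine g.contDiffAt_symm hz (f₀' := L') ?_ h2
    rw [hL']
    exact (h2.differentiableAt (by simp)).hasFDerivAt
  · have h1 : g.symm (g₁ p) ∈ g.source := g.map_target (ht ▸ hpR)
    have h2 : g.symm (g₁ p) = p := g₁.left_inv hpg₁
    exact h2 ▸ h1

/-! ### Orthonormal pairs of vector fields and arclength coordinates -/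

theorem ContDiffOn.differentiableAt_of_isOpen {X F : Type*} [NormedAddCommGroup X]
    [NormedSpace ℝ X] [NormedAddCommGroup F] [NormedSpace ℝ F] {H : X → F} {U : Set X}
    (h : ContDiffOn ℝ ∞ H U) (hU : IsOpen U) {y : X} (hy : y ∈ U) : DifferentiableAt ℝ H y :=
  (h.contDiffAt (hU.mem_nhds hy)).differentiableAt (by simp)

/-- A time-like and a space-like smooth vector field on `U`, orthonormal at every point. -/
structure IsFramePair (A B : E2 → E31) (U : Set E2) : Prop where
  smooth_left : ContDiffOn ℝ ∞ A U
  smooth_right : ContDiffOn ℝ ∞ B U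
  left_left : ∀ y ∈ U, mink (A y) (A y) = -1
  right_right : ∀ y ∈ U, mink (B y) (B y) = 1
  left_right : ∀ y ∈ U, mink (A y) (B y) = 0

namespace IsFramePair

variable {A B : E2 → E31} {U : Set E2}

theorem mink_cross_self (h : IsFramePair A B U) {y : E2} (hy : y ∈ U) :
    mink (lorentzCross (B y) (A y)) (lorentzCross (B y) (A y)) = 1 := by
  rw [mink_cross_cross, mink_comm, h.left_right y hy, h.left_left y hy, h.right_right y hy]
  norm_num

/-- If `dA` is orthogonal to `B`, it is a multiple of the third frame vector `B ∧ A`. -/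
theorem fderiv_left_eq (h : IsFramePair A B U) (hU : IsOpen U) {y : E2} (hy : y ∈ U) {v : E2}
    (hperp : mink (fderiv ℝ A y v) (B y) = 0) :
    fderiv ℝ A y v = mink (fderiv ℝ A y v) (lorentzCross (B y) (A y)) •
      lorentzCross (B y) (A y) := by
  have hA := h.smooth_left.differentiableAt_of_isOpen hU hy
  have h1 := mink_fderiv_self hU hy hA h.left_left v
  have hC := h.mink_cross_self hy
  rw [← sub_eq_zero]
  refine eq_zero_of_mink_frame (a := A y) (b := B y) (c := lorentzCross (B y) (A y))
    ?_ ?_ ?_ (h.left_right y hy) (by simp) (by simp) ?_ ?_ ?_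
  · rw [h.left_left y hy]; norm_num
  · rw [h.right_right y hy]; norm_num
  · rw [hC]; norm_num
  · rw [mink_sub_left, mink_smul_left, h1, mink_comm _ (A y)]; simp
  · rw [mink_sub_left, mink_smul_left, hperp, mink_comm _ (B y)]; simp
  · simp [hC]

/-- A frame pair turned by the hyperbolic angle `σ` is a frame pair. -/
theorem rotate (h : IsFramePair A B U) {σ : E2 → ℝ} (hσ : ContDiffOn ℝ ∞ σ U) :
    IsFramePair (fun y => Real.cosh (σ y) • A y - Real.sinh (σ y) • B y)
      (fun y => Real.cosh (σ y) • B y - Real.sinh (σ y) • A y) U := by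
  have hc := Real.contDiff_cosh.comp_contDiffOn hσ
  have hs := Real.contDiff_sinh.comp_contDiffOn hσ
  refine ⟨(hc.smul h.smooth_left).sub (hs.smul h.smooth_right),
    (hc.smul h.smooth_right).sub (hs.smul h.smooth_left), fun y hy => ?_, fun y hy => ?_,
    fun y hy => ?_⟩ <;>
  · have h1 := h.left_left y hy
    have h2 := h.right_right y hy
    have h3 := h.left_right y hy
    have h4 := (mink_comm (B y) (A y)).trans h3
    have h5 := Real.cosh_sq_sub_sinh_sq (σ y)
    simp [h1, h2, h3, h4]
    linarith

theorem fderiv_rotate (h : IsFramePair A B U) (hU : IsOpen U) {σ : E2 → ℝ}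
    (hσ : ContDiffOn ℝ ∞ σ U) {y : E2} (hy : y ∈ U) (v : E2) :
    fderiv ℝ (fun y => Real.cosh (σ y) • A y - Real.sinh (σ y) • B y) y v =
      Real.cosh (σ y) • fderiv ℝ A y v + (fderiv ℝ σ y v * Real.sinh (σ y)) • A y -
        (Real.sinh (σ y) • fderiv ℝ B y v + (fderiv ℝ σ y v * Real.cosh (σ y)) • B y) := by
  have hA := h.smooth_left.differentiableAt_of_isOpen hU hy
  have hB := h.smooth_right.differentiableAt_of_isOpen hU hy
  have hs := (hσ.differentiableAt_of_isOpen hU hy).hasFDerivAt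
  have hder : HasFDerivAt (fun y => Real.cosh (σ y) • A y - Real.sinh (σ y) • B y) _ y :=
    (hs.cosh.smul hA.hasFDerivAt).sub (hs.sinh.smul hB.hasFDerivAt)
  rw [hder.fderiv]
  simp [mul_comm]

/-- If `⟨dA, B⟩ = dσ`, then turning the frame by the angle `σ` makes the derivative of its first
vector orthogonal to the second one. -/
theorem mink_fderiv_rotate (h : IsFramePair A B U) (hU : IsOpen U) {σ : E2 → ℝ}
    (hσ : ContDiffOn ℝ ∞ σ U) {y : E2} (hy : y ∈ U) {v : E2}
    (hd : mink (fderiv ℝ A y v) (B y) = fderiv ℝ σ y v) :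
    mink (fderiv ℝ (fun y => Real.cosh (σ y) • A y - Real.sinh (σ y) • B y) y v)
      (Real.cosh (σ y) • B y - Real.sinh (σ y) • A y) = 0 := by
  have hA := h.smooth_left.differentiableAt_of_isOpen hU hy
  have hB := h.smooth_right.differentiableAt_of_isOpen hU hy
  have h1 := h.left_left y hy
  have h2 := h.right_right y hy
  have h3 := h.left_right y hy
  have h4 := (mink_comm (B y) (A y)).trans h3
  have h5 := mink_fderiv_self hU hy hA h.left_left v
  have h6 := mink_fderiv_self hU hy hB h.right_right v
  have h7 := mink_fderiv_add_eq_zero hU hy hA hB h.left_right v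
  rw [mink_comm (A y), hd] at h7
  have h8 : mink (fderiv ℝ B y v) (A y) = -fderiv ℝ σ y v := by linarith
  rw [h.fderiv_rotate hU hσ hy]
  simp [h1, h2, h3, h4, h5, h6, h8, hd]
  ring

/-- Suppose that the first vector `Φ` of a frame pair moves orthogonally to the second one. Then
`Φ` is an arclength curve in a coordinate `t`, which completes a given function `a` to a chart. -/
theorem exists_arclength_chart {Φ Ψ : E2 → E31} (h : IsFramePair Φ Ψ U) (hU : IsOpen U)
    (hperp : ∀ y ∈ U, ∀ v, mink (fderiv ℝ Φ y v) (Ψ y) = 0) {a : E2 → ℝ}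
    (ha : ContDiffOn ℝ ∞ a U) {p : E2} (hp : p ∈ U)
    (hind : ∀ v, fderiv ℝ a p v = 0 → fderiv ℝ Φ p v = 0 → v = 0) :
    ∃ (g : OpenPartialHomeomorph E2 E2) (K : Fin 2 → Set ℝ) (φ : ℝ → E31), IsBoxChart g K ∧
      p ∈ g.source ∧ g.source ⊆ U ∧ (∀ y, g y 0 = a y) ∧ ContDiffOn ℝ ∞ φ (K 1) ∧
      ∀ y ∈ g.source, Φ y = φ (g y 1) ∧ deriv φ (g y 1) = lorentzCross (Ψ y) (Φ y) := by
  set C : E2 → E31 := fun y => lorentzCross (Ψ y) (Φ y) with hC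
  have hCC : ∀ y ∈ U, mink (C y) (C y) = 1 := fun y hy => h.mink_cross_self hy
  have hdΦ : ∀ y ∈ U, ∀ v, fderiv ℝ Φ y v = mink (fderiv ℝ Φ y v) (C y) • C y := fun y hy v =>
    h.fderiv_left_eq hU hy (hperp y hy v)
  -- near `p`, the component of `Φ` along `C p` can replace the arclength as a coordinate
  set τ : E2 → ℝ := fun y => mink (Φ y) (C p) with hτ
  have hτs : ContDiffOn ℝ ∞ τ U := h.smooth_left.mink contDiffOn_const
  have hdτ : ∀ y ∈ U, ∀ v,
      fderiv ℝ τ y v = mink (fderiv ℝ Φ y v) (C y) * mink (C y) (C p) := by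
    intro y hy v
    rw [hτ, fderiv_mink (h.smooth_left.differentiableAt_of_isOpen hU hy)
      (differentiableAt_const _)]
    conv_lhs => rw [hdΦ y hy v]
    simp
  have hCs : ContDiffOn ℝ ∞ C U := h.smooth_right.lorentzCross h.smooth_left
  set U₁ := U ∩ (fun y => mink (C y) (C p)) ⁻¹' Set.Ioi 0 with hU₁def
  have hU₁ : IsOpen U₁ :=
    (hCs.mink contDiffOn_const).continuousOn.isOpen_inter_preimage hU isOpen_Ioi
  have hU₁U : U₁ ⊆ U := Set.inter_subset_left
  have hp₁ : p ∈ U₁ := ⟨hp, by simp [hCC p hp]⟩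
  obtain ⟨g₁, K₁, hg₁, hpg₁, hg₁U, hg₁c⟩ := exists_isBoxChart hU₁ hp₁ (a := ![a, τ])
    (by intro i; fin_cases i; exacts [ha.mono hU₁U, hτs.mono hU₁U]) (by
      intro v hv
      have h0 : fderiv ℝ a p v = 0 := hv 0
      have h1 : fderiv ℝ τ p v = 0 := hv 1
      rw [hdτ p hp, hCC p hp, mul_one] at h1
      exact hind v h0 (by rw [hdΦ p hp, h1, zero_smul]))
  have hg₁τ : ∀ y, g₁ y 1 = τ y := fun y => hg₁c y 1
  have hs₁U : g₁.source ⊆ U := hg₁U.trans hU₁U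
  obtain ⟨φ₁, hφ₁, hΦ₁⟩ := hg₁.exists_eq_comp (j := 1) (h.smooth_left.mono hs₁U) (by
    intro y hy v hv
    simp only [hg₁τ] at hv
    rw [hdτ y (hs₁U hy), mul_eq_zero] at hv
    rw [hdΦ y (hs₁U hy), hv.resolve_right (ne_of_gt (hg₁U hy).2), zero_smul])
  simp only [hg₁τ] at hΦ₁
  have hτK : ∀ y ∈ g₁.source, τ y ∈ K₁ 1 := fun y hy => hg₁τ y ▸ hg₁.coord_mem hy 1
  have hdiff₁ : ∀ y ∈ g₁.source, DifferentiableAt ℝ φ₁ (τ y) := fun y hy =>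
    hφ₁.differentiableAt_of_isOpen (hg₁.box.isOpen_side 1) (hτK y hy)
  have hderiv₁ : ∀ y ∈ g₁.source, deriv φ₁ (τ y) = (mink (C y) (C p))⁻¹ • C y := by
    intro y hy
    obtain ⟨v, hv⟩ := hg₁.exists_fderiv_coord_eq_one hy 1
    simp only [hg₁τ] at hv
    have h1 := fderiv_eq_smul_deriv_comp g₁.open_source hy (hdiff₁ y hy)
      (hτs.differentiableAt_of_isOpen hU (hs₁U hy)) hΦ₁ v
    rw [show fderiv ℝ (fun y => τ y) y v = fderiv ℝ τ y v from rfl] at hv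
    rw [hv, one_smul, hdΦ y (hs₁U hy)] at h1
    rw [hdτ y (hs₁U hy)] at hv
    rw [← h1, eq_inv_of_mul_eq_one_left hv]
  -- the speed of the curve in the coordinate `τ`, whose integral is the arclength
  have hspeed : ∀ y ∈ g₁.source,
      mink (deriv φ₁ (τ y)) (deriv φ₁ (τ y)) = (mink (C y) (C p))⁻¹ ^ 2 := by
    intro y hy
    rw [hderiv₁ y hy]
    simp [hCC y (hs₁U hy)]
    ring
  have hφ₁' : ContDiffOn ℝ ∞ (deriv φ₁) (K₁ 1) :=
    ((contDiffOn_infty_iff_deriv_of_isOpen (hg₁.box.isOpen_side 1)).1 hφ₁).2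
  obtain ⟨η, hη, -, hη'⟩ := exists_smooth_antideriv (hg₁.box.isOpen_side 1)
    (hg₁.box.ordConnected 1) (g := fun r => Real.sqrt (mink (deriv φ₁ r) (deriv φ₁ r)))
    ((hφ₁'.mink hφ₁').sqrt (by
      intro r hr
      obtain ⟨y, hy, rfl⟩ := hg₁.exists_coord_eq hr
      rw [hg₁τ, hspeed y hy]
      exact (pow_pos (inv_pos.2 (hg₁U hy).2) 2).ne')) (hτK p hpg₁)
  set t : E2 → ℝ := fun y => η (τ y) with ht
  have hts : ContDiffOn ℝ ∞ t g₁.source := hη.comp (hτs.mono hs₁U) hτK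
  have hdt : ∀ y ∈ g₁.source, ∀ v, fderiv ℝ t y v = mink (fderiv ℝ Φ y v) (C y) := by
    intro y hy v
    have h1 := hη' (τ y) (hτK y hy)
    have h2 : (0 : ℝ) < mink (C y) (C p) := (hg₁U hy).2
    rw [fderiv_eq_smul_deriv_comp g₁.open_source hy h1.differentiableAt
      (hτs.differentiableAt_of_isOpen hU (hs₁U hy)) (fun _ _ => rfl) v, h1.deriv, hspeed y hy,
      Real.sqrt_sq (inv_pos.2 h2).le, hdτ y (hs₁U hy), smul_eq_mul, mul_assoc,
      mul_inv_cancel₀ h2.ne', mul_one]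
  obtain ⟨g, K, hg, hpg, hgs, hgc⟩ := exists_isBoxChart g₁.open_source hpg₁ (a := ![a, t])
    (by intro i; fin_cases i; exacts [ha.mono hs₁U, hts]) (by
      intro v hv
      have h0 : fderiv ℝ a p v = 0 := hv 0
      have h1 : fderiv ℝ t p v = 0 := hv 1
      rw [hdt p hpg₁] at h1
      exact hind v h0 (by rw [hdΦ p hp, h1, zero_smul]))
  have hgt : ∀ y, g y 1 = t y := fun y => hgc y 1
  have hsU : g.source ⊆ U := hgs.trans hs₁U
  obtain ⟨φ, hφ, hΦ⟩ := hg.exists_eq_comp (j := 1) (h.smooth_left.mono hsU) (by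
    intro y hy v hv
    simp only [hgt] at hv
    have hv' : fderiv ℝ t y v = 0 := hv
    rw [hdt y (hgs hy)] at hv'
    rw [hdΦ y (hsU hy), hv', zero_smul])
  refine ⟨g, K, φ, hg, hpg, hsU, fun y => hgc y 0, hφ, fun y hy => ⟨hΦ y hy, ?_⟩⟩
  obtain ⟨v, hv⟩ := hg.exists_fderiv_coord_eq_one hy 1
  have h1 := fderiv_eq_smul_deriv_comp g.open_source hy
    (hφ.differentiableAt_of_isOpen (hg.box.isOpen_side 1) (hg.coord_mem hy 1))
    ((hg.smooth_coord 1).differentiableAt_of_isOpen g.open_source hy) hΦ v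
  simp only [hgt] at hv h1 ⊢
  have hv' : fderiv ℝ t y v = 1 := hv
  rw [hv, one_smul, hdΦ y (hsU hy), ← hdt y (hgs hy), hv', one_smul] at h1
  exact h1.symm

end IsFramePair

/-! ### Generalized constant ratio surfaces in local coordinates -/

/-- The coordinate expression of a space-like surface in the time-like cone: `f` is the surface
and `n` its unit normal field, both written in a chart with values in the open set `U`. -/
structure IsLocalSurface (f n : E2 → E31) (U : Set E2) : Prop where
  isOpen : IsOpen U
  smooth : ContDiffOn ℝ ∞ f U
  smooth_normal : ContDiffOn ℝ ∞ n U
  spacelike : ∀ y ∈ U, ∀ v, v ≠ 0 → 0 < mink (fderiv ℝ f y v) (fderiv ℝ f y v)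
  unit : ∀ y ∈ U, mink (n y) (n y) = -1
  normal : ∀ y ∈ U, ∀ v, mink (n y) (fderiv ℝ f y v) = 0
  cone : ∀ y ∈ U, mink (f y) (f y) < 0

/-- The tangential part of the position vector, which is the image of `v`, is nonzero and an
eigenvector of the derivative of the normal field. -/
def IsPrincipalPosition (f n : E2 → E31) (y : E2) : Prop :=
  ∃ v : E2, v ≠ 0 ∧ (∀ z, mink (f y - fderiv ℝ f y v) (fderiv ℝ f y z) = 0) ∧
    ∃ k : ℝ, fderiv ℝ n y v = k • fderiv ℝ f y v

namespace IsLocalSurface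

variable {f n : E2 → E31} {U : Set E2} {y : E2}

theorem differentiableAt (h : IsLocalSurface f n U) (hy : y ∈ U) : DifferentiableAt ℝ f y :=
  h.smooth.differentiableAt_of_isOpen h.isOpen hy

theorem differentiableAt_normal (h : IsLocalSurface f n U) (hy : y ∈ U) :
    DifferentiableAt ℝ n y :=
  h.smooth_normal.differentiableAt_of_isOpen h.isOpen hy

theorem eq_zero_of_fderiv_eq_zero (h : IsLocalSurface f n U) (hy : y ∈ U) {v : E2}
    (hv : fderiv ℝ f y v = 0) : v = 0 := by
  by_contra hne
  have := h.spacelike y hy v hne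
  rw [hv] at this
  simp at this

/-- A vector orthogonal to the normal and to the tangent plane vanishes. -/
theorem eq_zero_of_perp (h : IsLocalSurface f n U) (hy : y ∈ U) {w : E31}
    (hn : mink w (n y) = 0) (ht : ∀ z, mink w (fderiv ℝ f y z) = 0) : w = 0 := by
  set D := fderiv ℝ f y with hD
  have h0 : 0 < mink (D (coordVec 0)) (D (coordVec 0)) := h.spacelike y hy _ (by simp)
  -- the Gram-Schmidt correction of the second coordinate vector
  set e : E2 := coordVec 1 -
    (mink (D (coordVec 0)) (D (coordVec 1)) / mink (D (coordVec 0)) (D (coordVec 0))) •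
      coordVec 0 with he
  have he0 : e ≠ 0 := by
    intro h1
    have h2 := congrArg (fun v : E2 => v 1) h1
    simp [he] at h2
  refine eq_zero_of_mink_frame (a := n y) (b := D (coordVec 0)) (c := D e) ?_ h0.ne'
    (h.spacelike y hy e he0).ne' (h.normal y hy _) (h.normal y hy _) ?_ hn (ht _) (ht _)
  · rw [h.unit y hy]; norm_num
  · rw [he, map_sub, map_smul, mink_sub_right, mink_smul_right, div_mul_cancel₀ _ h0.ne', sub_self]

/-- The second fundamental form is symmetric. -/
theorem second_form_symm (h : IsLocalSurface f n U) (hy : y ∈ U) (v w : E2) :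
    mink (fderiv ℝ n y v) (fderiv ℝ f y w) = mink (fderiv ℝ n y w) (fderiv ℝ f y v) := by
  have hfd : DifferentiableAt ℝ (fderiv ℝ f) y :=
    ((h.smooth.fderiv_of_isOpen h.isOpen (m := ∞) (by simp)).contDiffAt
      (h.isOpen.mem_nhds hy)).differentiableAt (by simp)
  have hsymm : IsSymmSndFDerivAt ℝ f y :=
    (h.smooth.contDiffAt (h.isOpen.mem_nhds hy)).isSymmSndFDerivAt
      (by rw [minSmoothness_of_isRCLikeNormedField]; exact WithTop.coe_le_coe.2 le_top)
  have key : ∀ v w, mink (fderiv ℝ n y v) (fderiv ℝ f y w) +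
      mink (n y) (fderiv ℝ (fderiv ℝ f) y v w) = 0 := by
    intro v w
    have h1 := hfd.hasFDerivAt.clm_apply (hasFDerivAt_const w y)
    have h2 := mink_fderiv_add_eq_zero (G := fun z => fderiv ℝ f z w) h.isOpen hy
      (h.differentiableAt_normal hy) h1.differentiableAt (fun z hz => h.normal z hz w) v
    rw [h1.fderiv] at h2
    simpa using h2
  have h1 := key v w
  have h2 := key w v
  rw [hsymm.eq v w] at h1
  linarith

/-- At a point where `x^T` is a principal direction, the support function `⟨x, N⟩` has a
differential proportional to that of `⟨x, x⟩`, which does not vanish. -/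
theorem fderiv_support (h : IsLocalSurface f n U) (hy : y ∈ U) (hp : IsPrincipalPosition f n y) :
    (∃ k : ℝ, ∀ v, fderiv ℝ (fun y => mink (f y) (n y)) y v = k * mink (f y) (fderiv ℝ f y v)) ∧
      0 < mink (f y) (n y) ^ 2 + mink (f y) (f y) ∧ ∃ v, mink (f y) (fderiv ℝ f y v) ≠ 0 := by
  obtain ⟨T, hT, hperp, k, hk⟩ := hp
  have hpos := h.spacelike y hy T hT
  have hnn := h.unit y hy
  have htan : ∀ z, mink (f y) (fderiv ℝ f y z) = mink (fderiv ℝ f y T) (fderiv ℝ f y z) := by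
    intro z
    have := hperp z
    rw [mink_sub_left] at this
    linarith
  have hf : f y = fderiv ℝ f y T - mink (f y) (n y) • n y := by
    rw [← sub_eq_zero]
    refine h.eq_zero_of_perp hy ?_ fun z => ?_
    · simp [hnn, mink_comm _ (n y), h.normal y hy]
    · simp [h.normal y hy, htan]
  refine ⟨⟨k, fun v => ?_⟩, ?_, T, ?_⟩
  · have h1 := mink_fderiv_self h.isOpen hy (h.differentiableAt_normal hy) h.unit v
    rw [fderiv_mink (h.differentiableAt hy) (h.differentiableAt_normal hy), mink_comm _ (n y),
      h.normal y hy, zero_add, mink_comm]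
    calc mink (fderiv ℝ n y v) (f y)
        = mink (fderiv ℝ n y v) (fderiv ℝ f y T) := by
          conv_lhs => rw [hf]
          simp [h1]
      _ = k * mink (f y) (fderiv ℝ f y v) := by
          rw [h.second_form_symm hy, hk, mink_smul_left, htan]
  · have h2 : mink (f y) (f y) =
        mink (fderiv ℝ f y T) (fderiv ℝ f y T) - mink (f y) (n y) ^ 2 := by
      conv_lhs => rw [hf]
      simp [hnn, h.normal y hy, mink_comm _ (n y)]
      ring
    linarith
  · rw [htan]
    exact hpos.ne'

/-- The radius `√(-⟨x, x⟩)`, which will be the coordinate `s`, is smooth in the open cone. -/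
theorem smooth_radius (h : IsLocalSurface f n U) :
    ContDiffOn ℝ ∞ (fun y => Real.sqrt (-mink (f y) (f y))) U :=
  ((h.smooth.mink h.smooth).neg).sqrt fun y hy => by
    have := h.cone y hy
    linarith

/-- The gradient of the radius is a multiple of the tangential part of the position vector. -/
theorem radius_mul_fderiv (h : IsLocalSurface f n U) (hy : y ∈ U) (v : E2) :
    Real.sqrt (-mink (f y) (f y)) * fderiv ℝ (fun y => Real.sqrt (-mink (f y) (f y))) y v =
      -mink (f y) (fderiv ℝ f y v) := by
  have h0 := h.cone y hy
  have hd := h.differentiableAt hy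
  have hs := Real.sqrt_pos.2 (neg_pos.2 h0)
  have h1 := ((hd.mink hd).hasFDerivAt.neg).sqrt (neg_pos.2 h0).ne'
  rw [show (fun y => Real.sqrt (-mink (f y) (f y))) =
    fun y => Real.sqrt ((-fun y => mink (f y) (f y)) y) from rfl, h1.fderiv]
  simp only [Pi.neg_apply, smul_apply, neg_apply,
    fderiv_mink hd hd, smul_eq_mul, mink_comm (fderiv ℝ f y v)]
  field_simp
  ring

/-- A generalized constant ratio surface has the coordinates `(s, t)`. Here `s` is the radius. The
support function `⟨x, N⟩` is a function of `s`, hence so is the hyperbolic angle between `x` and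
`N`; turning the frame of the plane `span (x, N)` by an angle `u(s)` gives a frame whose
time-like vector `φ` depends on one coordinate `t` only. -/
theorem exists_gcr_chart (h : IsLocalSurface f n U) (hgcr : ∀ y ∈ U, IsPrincipalPosition f n y)
    {p : E2} (hp : p ∈ U) :
    ∃ (g : OpenPartialHomeomorph E2 E2) (K : Fin 2 → Set ℝ) (u : ℝ → ℝ) (φ : ℝ → E31),
      IsBoxChart g K ∧ p ∈ g.source ∧ g.source ⊆ U ∧ ContDiffOn ℝ ∞ u (K 0) ∧
      IsArclengthCurve (K 1) φ ∧ ∀ y ∈ g.source,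
        f y = g y 0 • (Real.cosh (u (g y 0)) • φ (g y 1) +
          Real.sinh (u (g y 0)) • lorentzCross (φ (g y 1)) (deriv φ (g y 1))) := by
  set s : E2 → ℝ := fun y => Real.sqrt (-mink (f y) (f y)) with hs
  set μ : E2 → ℝ := fun y => mink (f y) (n y) with hμ
  have hss : ContDiffOn ℝ ∞ s U := h.smooth_radius
  have hs0 : ∀ y ∈ U, 0 < s y := fun y hy => Real.sqrt_pos.2 (neg_pos.2 (h.cone y hy))
  have hs2 : ∀ y ∈ U, mink (f y) (f y) = -s y ^ 2 := fun y hy => by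
    rw [hs, Real.sq_sqrt (neg_pos.2 (h.cone y hy)).le, neg_neg]
  have hds : ∀ y ∈ U, ∀ v, s y * fderiv ℝ s y v = -mink (f y) (fderiv ℝ f y v) := fun y hy v =>
    h.radius_mul_fderiv hy v
  have hμs : ContDiffOn ℝ ∞ μ U := h.smooth.mink h.smooth_normal
  -- `s` is a submersion at `p`, so it can be completed to a chart by a linear function
  set α := fderiv ℝ s p (coordVec 0) with hα
  set β := fderiv ℝ s p (coordVec 1) with hβ
  have hdecomp : ∀ v : E2, fderiv ℝ s p v = v 0 * α + v 1 * β := by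
    intro v
    have hv : v = v 0 • coordVec 0 + v 1 • coordVec 1 := by
      ext i; fin_cases i <;> simp
    conv_lhs => rw [hv]
    simp only [map_add, map_smul, smul_eq_mul, hα, hβ]
  have hαβ : α ^ 2 + β ^ 2 ≠ 0 := by
    intro h0
    obtain ⟨-, -, v, hv⟩ := h.fderiv_support hp (hgcr p hp)
    have h1 : α = 0 := by nlinarith
    have h2 : β = 0 := by nlinarith
    have h3 := hds p hp v
    rw [hdecomp, h1, h2] at h3
    simp at h3
    exact hv h3
  set l : E2 →L[ℝ] ℝ := (-β) • coordCLM 0 + α • coordCLM 1 with hl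
  obtain ⟨g₁, K₁, hg₁, hpg₁, hg₁U, hg₁c⟩ := exists_isBoxChart h.isOpen hp (a := ![s, l])
    (by intro i; fin_cases i; exacts [hss, l.contDiff.contDiffOn]) (by
      intro v hv
      have h0 : fderiv ℝ s p v = 0 := hv 0
      have h1 : fderiv ℝ l p v = 0 := hv 1
      rw [hdecomp] at h0
      rw [l.fderiv] at h1
      simp [hl] at h1
      have e0 : (α ^ 2 + β ^ 2) * v 0 = 0 := by linear_combination α * h0 - β * h1
      have e1 : (α ^ 2 + β ^ 2) * v 1 = 0 := by linear_combination β * h0 + α * h1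
      ext i
      fin_cases i
      exacts [(mul_eq_zero.1 e0).resolve_left hαβ, (mul_eq_zero.1 e1).resolve_left hαβ])
  have hg₁s : ∀ y, g₁ y 0 = s y := fun y => hg₁c y 0
  have hsK : ∀ y ∈ g₁.source, s y ∈ K₁ 0 := fun y hy => hg₁s y ▸ hg₁.coord_mem hy 0
  -- the support function is a function `m` of the radius: its differential is a multiple of `ds`
  obtain ⟨m, hm, hμm⟩ := hg₁.exists_eq_comp (j := 0) (hμs.mono hg₁U) (by
    intro y hy v hv
    simp only [hg₁s] at hv
    obtain ⟨⟨k, hk⟩, -⟩ := h.fderiv_support (hg₁U hy) (hgcr y (hg₁U hy))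
    have h1 := hds y (hg₁U hy) v
    rw [show fderiv ℝ s y v = 0 from hv, mul_zero] at h1
    rw [hμ, hk, ← neg_neg (mink _ _), ← h1]
    simp)
  simp only [hg₁s] at hμm
  have hpos : ∀ r ∈ K₁ 0, 0 < r ∧ 0 < m r ^ 2 - r ^ 2 := by
    intro r hr
    obtain ⟨y, hy, rfl⟩ := hg₁.exists_coord_eq hr
    rw [hg₁s, ← hμm y hy]
    have h1 := (h.fderiv_support (hg₁U hy) (hgcr y (hg₁U hy))).2.1
    rw [hs2 y (hg₁U hy)] at h1
    exact ⟨hs0 y (hg₁U hy), by linarith⟩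
  -- `W(s)` is the length of `x^T`
  set W : ℝ → ℝ := fun r => Real.sqrt (m r ^ 2 - r ^ 2) with hW
  have hWs : ContDiffOn ℝ ∞ W (K₁ 0) :=
    ((hm.pow 2).sub (contDiffOn_id.pow 2)).sqrt fun r hr => (hpos r hr).2.ne'
  have hW0 : ∀ r ∈ K₁ 0, 0 < W r := fun r hr => Real.sqrt_pos.2 (hpos r hr).2
  have hW2 : ∀ r ∈ K₁ 0, W r ^ 2 = m r ^ 2 - r ^ 2 := fun r hr => Real.sq_sqrt (hpos r hr).2.le
  -- the angle vanishes at `p`, so that `φ` is regular there (parallel curves of a regular curve can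
  -- be singular)
  obtain ⟨u, hu, hup, hu'⟩ := exists_smooth_antideriv (hg₁.box.isOpen_side 0)
    (hg₁.box.ordConnected 0) (g := fun r => -m r / (r * W r))
    (hm.neg.div (contDiffOn_id.mul hWs) fun r hr =>
      (mul_pos (hpos r hr).1 (hW0 r hr)).ne') (hsK p hpg₁)
  have hs1 : ContDiffOn ℝ ∞ s g₁.source := hss.mono hg₁U
  -- `A, B` is the orthonormal frame of `span (x, N)` with `A` along the position vector
  set A : E2 → E31 := fun y => (s y)⁻¹ • f y with hA
  set B : E2 → E31 := fun y => (W (s y))⁻¹ • (s y • n y + (m (s y) / s y) • f y) with hB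
  have hff : ∀ y ∈ g₁.source, mink (f y) (f y) = -s y ^ 2 := fun y hy => hs2 y (hg₁U hy)
  have hfn : ∀ y ∈ g₁.source, mink (f y) (n y) = m (s y) := fun y hy => hμm y hy
  have hnf : ∀ y ∈ g₁.source, mink (n y) (f y) = m (s y) := fun y hy =>
    (mink_comm _ _).trans (hμm y hy)
  have hnn : ∀ y ∈ g₁.source, mink (n y) (n y) = -1 := fun y hy => h.unit y (hg₁U hy)
  have hs0' : ∀ y ∈ g₁.source, s y ≠ 0 := fun y hy => (hs0 y (hg₁U hy)).ne'
  have hWne : ∀ y ∈ g₁.source, W (s y) ≠ 0 := fun y hy => (hW0 _ (hsK y hy)).ne'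
  have hAB : IsFramePair A B g₁.source := by
    refine ⟨(hs1.inv hs0').smul (h.smooth.mono hg₁U),
      ((hWs.comp hs1 hsK).inv hWne).smul ((hs1.smul (h.smooth_normal.mono hg₁U)).add
        (((hm.comp hs1 hsK).div hs1 hs0').smul (h.smooth.mono hg₁U))), ?_, ?_, ?_⟩
    · intro y hy
      have h0 := hs0' y hy
      simp [hA, hff y hy]
      field_simp
    · intro y hy
      have h0 := hs0' y hy
      have h1 := hWne y hy
      simp [hB, hff y hy, hfn y hy, hnf y hy, hnn y hy]
      field_simp
      rw [hW2 _ (hsK y hy)]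
      ring
    · intro y hy
      have h0 := hs0' y hy
      have h1 := hWne y hy
      simp [hA, hB, hff y hy, hfn y hy]
      field_simp
      ring
  have hfA : ∀ y ∈ g₁.source, f y = s y • A y := fun y hy => by
    rw [hA, smul_smul, mul_inv_cancel₀ (hs0' y hy), one_smul]
  have hDf : ∀ y ∈ g₁.source, ∀ v,
      fderiv ℝ f y v = s y • fderiv ℝ A y v + fderiv ℝ s y v • A y := by
    intro y hy v
    have h1 : f =ᶠ[nhds y] fun y => s y • A y := by
      filter_upwards [g₁.open_source.mem_nhds hy] with z hz using hfA z hz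
    have h2 : HasFDerivAt (fun y => s y • A y) _ y :=
      (hs1.differentiableAt_of_isOpen g₁.open_source hy).hasFDerivAt.smul
        (hAB.smooth_left.differentiableAt_of_isOpen g₁.open_source hy).hasFDerivAt
    rw [h1.fderiv_eq, h2.fderiv]
    simp
  set σ : E2 → ℝ := fun y => u (s y) with hσ
  have hσs : ContDiffOn ℝ ∞ σ g₁.source := hu.comp hs1 hsK
  have hdσ : ∀ y ∈ g₁.source, ∀ v,
      fderiv ℝ σ y v = fderiv ℝ s y v * (-m (s y) / (s y * W (s y))) := by
    intro y hy v
    have h1 := hu' (s y) (hsK y hy)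
    rw [fderiv_eq_smul_deriv_comp g₁.open_source hy h1.differentiableAt
      (hs1.differentiableAt_of_isOpen g₁.open_source hy) (fun _ _ => rfl) v, h1.deriv, smul_eq_mul]
  -- `u' = -m / (s W)` is exactly the rate at which `A` turns towards `B`
  have hdA : ∀ y ∈ g₁.source, ∀ v, mink (fderiv ℝ A y v) (B y) = fderiv ℝ σ y v := by
    intro y hy v
    have h0 := hs0' y hy
    have h1 := hWne y hy
    have h2 := congrArg (fun w => mink w (B y)) (hDf y hy v)
    have h3 := hds y (hg₁U hy) v
    have h4 := h.normal y (hg₁U hy) v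
    rw [mink_comm] at h3 h4
    simp only [mink_add_left, mink_smul_left, hAB.left_right y hy, mul_zero, add_zero] at h2
    rw [hdσ y hy, ← mul_right_inj' h0, ← h2, hB, mink_smul_right, mink_add_right,
      mink_smul_right, mink_smul_right, h4, ← neg_neg (mink _ (f y)), ← h3]
    field_simp
    ring
  have hrot := hAB.rotate hσs
  obtain ⟨g, K, φ, hg, hpg, hgU, hgs, hφ, hΦ⟩ := hrot.exists_arclength_chart g₁.open_source
    (fun y hy v => hAB.mink_fderiv_rotate g₁.open_source hσs hy (hdA y hy v)) hs1 hpg₁ (by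
      intro v hv0 hv
      rw [hAB.fderiv_rotate g₁.open_source hσs hpg₁, hdσ p hpg₁, hv0] at hv
      have hσp : σ p = 0 := hup
      simp [hσp] at hv
      refine h.eq_zero_of_fderiv_eq_zero hp ?_
      rw [hDf p hpg₁, hv, hv0]
      simp)
  have hKK : ∀ r ∈ K 0, r ∈ K₁ 0 := by
    intro r hr
    obtain ⟨y, hy, rfl⟩ := hg.exists_coord_eq hr
    rw [hgs]
    exact hsK y (hgU hy)
  refine ⟨g, K, u, φ, hg, hpg, hgU.trans hg₁U, hu.mono hKK, ⟨hφ, ?_, ?_⟩, ?_⟩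
  · intro r hr
    obtain ⟨y, hy, rfl⟩ := hg.exists_coord_eq hr
    rw [← (hΦ y hy).1]
    exact hrot.left_left y (hgU hy)
  · intro r hr
    obtain ⟨y, hy, rfl⟩ := hg.exists_coord_eq hr
    rw [(hΦ y hy).2]
    exact hrot.mink_cross_self (hgU hy)
  · intro y hy
    have hy₁ := hgU hy
    rw [(hΦ y hy).2, ← (hΦ y hy).1, lorentzCross_lorentzCross, hrot.left_right y hy₁,
      hrot.left_left y hy₁, hgs, hfA y hy₁]
    have h1 := Real.cosh_sq_sub_sinh_sq (σ y)
    have h2 : u (s y) = σ y := rfl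
    rw [h2]
    ext i
    simp
    left
    linear_combination (-A y i) * h1

end IsLocalSurface

/-! ### The explicit parametrization -/

/-- A local surface on a box, given by `s (cosh u(s) φ(t) + sinh u(s) φ(t) ∧ φ'(t))` in the
standard coordinates `(s, t)` of the plane. -/
structure IsExplicitGCR (f n : E2 → E31) (U : Set E2) (K : Fin 2 → Set ℝ) (u : ℝ → ℝ)
    (φ : ℝ → E31) : Prop where
  surface : IsLocalSurface f n U
  box : IsBox U K
  smooth_u : ContDiffOn ℝ ∞ u (K 0)
  curve : IsArclengthCurve (K 1) φ
  eq : ∀ y ∈ U, f y = y 0 • (Real.cosh (u (y 0)) • φ (y 1) +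
    Real.sinh (u (y 0)) • lorentzCross (φ (y 1)) (deriv φ (y 1)))

namespace IsArclengthCurve

variable {J : Set ℝ} {φ : ℝ → E31} {t : ℝ}

theorem smooth_deriv (h : IsArclengthCurve J φ) (hJ : IsOpen J) : ContDiffOn ℝ ∞ (deriv φ) J :=
  ((contDiffOn_infty_iff_deriv_of_isOpen hJ).1 h.smooth).2

theorem mink_self (h : IsArclengthCurve J φ) (ht : t ∈ J) : mink (φ t) (φ t) = -1 := h.mem t ht

theorem mink_deriv (h : IsArclengthCurve J φ) (hJ : IsOpen J) (ht : t ∈ J) :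
    mink (φ t) (deriv φ t) = 0 := by
  have hd := h.smooth.differentiableAt_of_isOpen hJ ht
  have := mink_deriv_add_eq_zero hJ ht hd hd fun z hz => h.mink_self hz
  rw [mink_comm (deriv φ t)] at this
  linarith

theorem mink_cross (h : IsArclengthCurve J φ) (hJ : IsOpen J) (ht : t ∈ J) :
    mink (lorentzCross (φ t) (deriv φ t)) (lorentzCross (φ t) (deriv φ t)) = 1 := by
  rw [mink_cross_cross, h.mink_deriv hJ ht, h.mink_self ht, h.unit_speed t ht]
  norm_num

theorem differentiableAt_cross (h : IsArclengthCurve J φ) (hJ : IsOpen J) (ht : t ∈ J) :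
    DifferentiableAt ℝ (fun t => lorentzCross (φ t) (deriv φ t)) t :=
  (h.smooth.lorentzCross (h.smooth_deriv hJ)).differentiableAt_of_isOpen hJ ht

/-- The conormal `φ ∧ φ'` of a curve in the hyperbolic plane changes in the direction of `φ'`. -/
theorem mink_deriv_cross (h : IsArclengthCurve J φ) (hJ : IsOpen J) (ht : t ∈ J) :
    mink (deriv (fun t => lorentzCross (φ t) (deriv φ t)) t) (φ t) = 0 ∧
      mink (deriv (fun t => lorentzCross (φ t) (deriv φ t)) t)
        (lorentzCross (φ t) (deriv φ t)) = 0 := by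
  have hd := h.smooth.differentiableAt_of_isOpen hJ ht
  have hc := h.differentiableAt_cross hJ ht
  have h1 := mink_deriv_add_eq_zero hJ ht hd hc (c := 0) fun z hz => by simp
  have h2 := mink_deriv_add_eq_zero hJ ht hc hc (c := 1) fun z hz => h.mink_cross hJ hz
  rw [mink_cross_self_right, zero_add, mink_comm] at h1
  rw [mink_comm (lorentzCross _ _)] at h2
  exact ⟨h1, by linarith⟩

end IsArclengthCurve

namespace IsExplicitGCR

variable {f n : E2 → E31} {U : Set E2} {K : Fin 2 → Set ℝ} {u : ℝ → ℝ} {φ : ℝ → E31} {y : E2}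

theorem coord_mem (h : IsExplicitGCR f n U K u φ) (hy : y ∈ U) (i : Fin 2) : y i ∈ K i :=
  h.box.mem_iff.1 hy i

/-- The products of the moving frame `φ, φ ∧ φ', φ'` of the generating curve. -/
theorem frame (h : IsExplicitGCR f n U K u φ) (hy : y ∈ U) :
    mink (φ (y 1)) (φ (y 1)) = -1 ∧ mink (φ (y 1)) (deriv φ (y 1)) = 0 ∧
      mink (deriv φ (y 1)) (φ (y 1)) = 0 ∧ mink (deriv φ (y 1)) (deriv φ (y 1)) = 1 ∧
      mink (lorentzCross (φ (y 1)) (deriv φ (y 1))) (lorentzCross (φ (y 1)) (deriv φ (y 1))) = 1 ∧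
      mink (lorentzCross (φ (y 1)) (deriv φ (y 1))) (φ (y 1)) = 0 ∧
      mink (lorentzCross (φ (y 1)) (deriv φ (y 1))) (deriv φ (y 1)) = 0 := by
  have hJ := h.box.isOpen_side 1
  have ht := h.coord_mem hy 1
  have h1 := h.curve.mink_deriv hJ ht
  refine ⟨h.curve.mink_self ht, h1, (mink_comm _ _).trans h1, h.curve.unit_speed _ ht,
    h.curve.mink_cross hJ ht, ?_, ?_⟩ <;> rw [mink_comm] <;> simp

theorem hasDerivAt_u (h : IsExplicitGCR f n U K u φ) (hy : y ∈ U) :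
    HasDerivAt u (deriv u (y 0)) (y 0) :=
  (h.smooth_u.differentiableAt_of_isOpen (h.box.isOpen_side 0) (h.coord_mem hy 0)).hasDerivAt

/-- The derivative in the direction of `s`. -/
theorem fderiv_zero (h : IsExplicitGCR f n U K u φ) (hy : y ∈ U) :
    fderiv ℝ f y (coordVec 0) =
      (Real.cosh (u (y 0)) + y 0 * deriv u (y 0) * Real.sinh (u (y 0))) • φ (y 1) +
      (Real.sinh (u (y 0)) + y 0 * deriv u (y 0) * Real.cosh (u (y 0))) •
        lorentzCross (φ (y 1)) (deriv φ (y 1)) := by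
  have hu := h.hasDerivAt_u hy
  refine fderiv_coordVec (h.surface.differentiableAt hy)
    (c := fun r => r • (Real.cosh (u r) • φ (y 1) +
      Real.sinh (u r) • lorentzCross (φ (y 1)) (deriv φ (y 1)))) ?_ ?_
  · have h1 : HasDerivAt (fun r => Real.cosh (u r) • φ (y 1) +
        Real.sinh (u r) • lorentzCross (φ (y 1)) (deriv φ (y 1)))
        ((Real.sinh (u (y 0)) * deriv u (y 0)) • φ (y 1) +
          (Real.cosh (u (y 0)) * deriv u (y 0)) • lorentzCross (φ (y 1)) (deriv φ (y 1))) (y 0) :=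
      (hu.cosh.smul_const _).add (hu.sinh.smul_const _)
    exact ((hasDerivAt_id' (y 0)).smul h1).congr_deriv (by module)
  · filter_upwards [(h.box.isOpen_side 0).mem_nhds (h.coord_mem hy 0)] with r hr
    simpa using h.eq _ (h.box.slide_mem hy hr)

/-- The derivative in the direction of `t` is a nonzero multiple of `φ'`. -/
theorem fderiv_one (h : IsExplicitGCR f n U K u φ) (hy : y ∈ U) :
    ∃ r : ℝ, r ≠ 0 ∧ fderiv ℝ f y (coordVec 1) = r • deriv φ (y 1) := by
  have hJ := h.box.isOpen_side 1
  have ht := h.coord_mem hy 1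
  obtain ⟨e1, e2, e3, e4, e5, e6, e7⟩ := h.frame hy
  obtain ⟨c1, c2⟩ := h.curve.mink_deriv_cross hJ ht
  set ψ : ℝ → E31 := fun t => lorentzCross (φ t) (deriv φ t) with hψ
  replace c2 : mink (deriv ψ (y 1)) (ψ (y 1)) = 0 := c2
  replace e7 : mink (ψ (y 1)) (deriv φ (y 1)) = 0 := e7
  have hD : fderiv ℝ f y (coordVec 1) =
      y 0 • (Real.cosh (u (y 0)) • deriv φ (y 1) + Real.sinh (u (y 0)) • deriv ψ (y 1)) := by
    refine fderiv_coordVec (h.surface.differentiableAt hy)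
      (c := fun r => y 0 • (Real.cosh (u (y 0)) • φ r + Real.sinh (u (y 0)) • ψ r)) ?_ ?_
    · exact ((((h.curve.smooth.differentiableAt_of_isOpen hJ ht).hasDerivAt.const_smul
        (Real.cosh (u (y 0)))).add ((h.curve.differentiableAt_cross hJ ht).hasDerivAt.const_smul
        (Real.sinh (u (y 0)))))).const_smul (y 0)
    · filter_upwards [hJ.mem_nhds ht] with r hr
      simpa using h.eq _ (h.box.slide_mem hy hr)
  have hD' : fderiv ℝ f y (coordVec 1) =
      mink (fderiv ℝ f y (coordVec 1)) (deriv φ (y 1)) • deriv φ (y 1) := by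
    rw [← sub_eq_zero]
    refine eq_zero_of_mink_frame (a := φ (y 1)) (b := ψ (y 1)) (c := deriv φ (y 1))
      (by rw [e1]; norm_num) (by rw [e5]; norm_num) (by rw [e4]; norm_num)
      (by simp [hψ]) e2 e7 ?_ ?_ ?_
    · rw [mink_sub_left, mink_smul_left, e3, hD]
      simp [e3, c1]
    · rw [mink_sub_left, mink_smul_left, mink_comm (deriv φ (y 1)) (ψ (y 1)), e7, hD]
      simp [mink_comm (deriv φ (y 1)) (ψ (y 1)), e7, c2]
    · simp [e4]
  refine ⟨_, fun h0 => ?_, hD'⟩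
  rw [h0, zero_smul] at hD'
  have := congrArg (fun v : E2 => v 1) (h.surface.eq_zero_of_fderiv_eq_zero hy hD')
  simp at this

theorem coord_ne_zero (h : IsExplicitGCR f n U K u φ) (hy : y ∈ U) : y 0 ≠ 0 := by
  intro h0
  have h1 := h.surface.cone y hy
  rw [h.eq y hy, h0] at h1
  simp at h1

theorem mink_fderiv_zero (h : IsExplicitGCR f n U K u φ) (hy : y ∈ U) :
    mink (fderiv ℝ f y (coordVec 0)) (fderiv ℝ f y (coordVec 0)) =
      (y 0 * deriv u (y 0)) ^ 2 - 1 := by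
  obtain ⟨e1, e2, e3, e4, e5, e6, e7⟩ := h.frame hy
  rw [h.fderiv_zero hy]
  have h1 := Real.cosh_sq_sub_sinh_sq (u (y 0))
  simp [e1, e5, e6]
  linear_combination ((y 0 * deriv u (y 0)) ^ 2 - 1) * h1

/-- The coordinate `s` may have either sign, but `|s u'| > 1` because the surface is space-like. -/
theorem one_lt_sq (h : IsExplicitGCR f n U K u φ) (hy : y ∈ U) :
    1 < (y 0 * deriv u (y 0)) ^ 2 := by
  have h1 := h.surface.spacelike y hy (coordVec 0) (by simp)
  rw [h.mink_fderiv_zero hy] at h1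
  linarith

/-- The normal is orthogonal to the tangent of the generating curve. -/
theorem mink_normal_deriv (h : IsExplicitGCR f n U K u φ) (hy : y ∈ U) :
    mink (n y) (deriv φ (y 1)) = 0 := by
  obtain ⟨r, hr, hD⟩ := h.fderiv_one hy
  have h1 := h.surface.normal y hy (coordVec 1)
  rw [hD, mink_smul_right] at h1
  exact (mul_eq_zero.1 h1).resolve_left hr

theorem mink_fderiv_zero_deriv (h : IsExplicitGCR f n U K u φ) (hy : y ∈ U) :
    mink (fderiv ℝ f y (coordVec 0)) (deriv φ (y 1)) = 0 := by
  obtain ⟨e1, e2, e3, e4, e5, e6, e7⟩ := h.frame hy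
  rw [h.fderiv_zero hy]
  simp [e2, e7]

/-- The tangential part of the position vector is a multiple of the coordinate field `∂_s`. -/
theorem tangential (h : IsExplicitGCR f n U K u φ) (hy : y ∈ U) (z : E2) :
    mink (f y - fderiv ℝ f y ((-y 0 / ((y 0 * deriv u (y 0)) ^ 2 - 1)) • coordVec 0))
      (fderiv ℝ f y z) = 0 := by
  obtain ⟨e1, e2, e3, e4, e5, e6, e7⟩ := h.frame hy
  obtain ⟨r, hr, hD⟩ := h.fderiv_one hy
  have h0 : (y 0 * deriv u (y 0)) ^ 2 - 1 ≠ 0 := by linarith [h.one_lt_sq hy]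
  have hz : z = z 0 • coordVec 0 + z 1 • coordVec 1 := by
    ext i; fin_cases i <;> simp
  have hf0 : mink (f y) (fderiv ℝ f y (coordVec 0)) = -y 0 := by
    have h1 := Real.cosh_sq_sub_sinh_sq (u (y 0))
    rw [h.eq y hy, h.fderiv_zero hy]
    simp [e1, e5, e6]
    linear_combination -(y 0) * h1
  have hf1 : mink (f y) (deriv φ (y 1)) = 0 := by
    rw [h.eq y hy]
    simp [e2, e7]
  rw [hz, map_add, map_smul, map_smul, map_smul, hD]
  simp only [mink_sub_left, mink_add_right, mink_smul_right, mink_smul_left, hf0, hf1,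
    h.mink_fderiv_zero hy, h.mink_fderiv_zero_deriv hy]
  generalize (y 0 * deriv u (y 0)) ^ 2 - 1 = c at h0 ⊢
  field_simp
  ring

/-- In the coordinates `(s, t)`, the direction of `x^T` is principal: along an `s`-line the normal
stays orthogonal to the fixed vector `φ'(t)`, so that its derivative is a multiple of `∂_s x`. -/
theorem isPrincipalPosition (h : IsExplicitGCR f n U K u φ) (hy : y ∈ U) :
    IsPrincipalPosition f n y := by
  have hw : 0 < (y 0 * deriv u (y 0)) ^ 2 - 1 := by linarith [h.one_lt_sq hy]
  obtain ⟨e1, e2, e3, e4, e5, e6, e7⟩ := h.frame hy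
  have hn := h.surface.differentiableAt_normal hy
  have hJ := h.box.isOpen_side 1
  set D := fderiv ℝ f y (coordVec 0) with hD
  have hDD : mink D D = _ := h.mink_fderiv_zero hy
  have hDφ : mink D (deriv φ (y 1)) = 0 := h.mink_fderiv_zero_deriv hy
  have hnD : mink (n y) D = 0 := h.surface.normal y hy _
  have hnn : mink (fderiv ℝ n y (coordVec 0)) (n y) = 0 :=
    mink_fderiv_self h.surface.isOpen hy hn h.surface.unit _
  have hnφ : mink (fderiv ℝ n y (coordVec 0)) (deriv φ (y 1)) = 0 := by
    have hd := (h.curve.smooth_deriv hJ).differentiableAt_of_isOpen hJ (h.coord_mem hy 1)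
    have h1 := (hasFDerivAt_coord 1 y).differentiableAt
    have h2 := mink_fderiv_add_eq_zero (G := fun z : E2 => deriv φ (z 1)) h.surface.isOpen hy hn
      (hd.comp (f := fun z : E2 => z 1) y h1) (fun z hz => h.mink_normal_deriv hz) (coordVec 0)
    rw [fderiv_eq_smul_deriv_comp h.surface.isOpen hy hd h1 (fun _ _ => rfl),
      (hasFDerivAt_coord 1 y).fderiv] at h2
    simpa using h2
  have hk : fderiv ℝ n y (coordVec 0) =
      (mink (fderiv ℝ n y (coordVec 0)) D / ((y 0 * deriv u (y 0)) ^ 2 - 1)) • D := by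
    rw [← sub_eq_zero]
    refine eq_zero_of_mink_frame (a := n y) (b := D) (c := deriv φ (y 1)) ?_ ?_ ?_ hnD
      (h.mink_normal_deriv hy) hDφ ?_ ?_ ?_
    · rw [h.surface.unit y hy]; norm_num
    · rw [hDD]; exact hw.ne'
    · rw [e4]; norm_num
    · rw [mink_sub_left, mink_smul_left, hnn, mink_comm D, hnD]; simp
    · rw [mink_sub_left, mink_smul_left, hDD, div_mul_cancel₀ _ hw.ne', sub_self]
    · rw [mink_sub_left, mink_smul_left, hnφ, hDφ]; simp
  refine ⟨_, smul_ne_zero (div_ne_zero (neg_ne_zero.2 (h.coord_ne_zero hy)) hw.ne') (by simp),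
    h.tangential hy, mink (fderiv ℝ n y (coordVec 0)) D / ((y 0 * deriv u (y 0)) ^ 2 - 1), ?_⟩
  rw [map_smul, map_smul]
  conv_lhs => rw [hk]
  exact smul_comm _ _ _

/-- The angle `θ` with `coth θ = s u'`, and the decomposition of the position vector along the unit
field `sinh θ ∂_s x` and one of the two unit normals. -/
theorem exists_decomposition (h : IsExplicitGCR f n U K u φ) :
    ∃ θ : ℝ → ℝ, ContDiffOn ℝ ∞ θ (K 0) ∧
      (∀ r ∈ K 0, θ r ≠ 0 ∧ coth (θ r) = r * deriv u r) ∧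
      ∃ ε : ℝ, (ε = 1 ∨ ε = -1) ∧ ∀ y ∈ U,
        mink (Real.sinh (θ (y 0)) • fderiv ℝ f y (coordVec 0))
          (Real.sinh (θ (y 0)) • fderiv ℝ f y (coordVec 0)) = 1 ∧
        f y = -(y 0) • (Real.sinh (θ (y 0)) • Real.sinh (θ (y 0)) • fderiv ℝ f y (coordVec 0) +
          Real.cosh (θ (y 0)) • ε • n y) := by
  have hI := h.box.isOpen_side 0
  have hlt : ∀ r ∈ K 0, 1 < (r * deriv u r) ^ 2 := by
    intro r hr
    obtain ⟨b, hb⟩ := h.box.exists_mem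
    have := h.one_lt_sq (h.box.slide_mem hb hr)
    simpa using this
  have hne : ∀ r ∈ K 0, r * deriv u r ≠ 0 := by
    intro r hr h0
    have := hlt r hr
    rw [h0] at this
    norm_num at this
  have hmem : ∀ r ∈ K 0, (r * deriv u r)⁻¹ ∈ Set.Ioo (-1 : ℝ) 1 := by
    intro r hr
    rw [Set.mem_Ioo, ← abs_lt, abs_inv]
    exact inv_lt_one_of_one_lt₀ (one_lt_sq_iff_one_lt_abs _ |>.1 (hlt r hr))
  set θ : ℝ → ℝ := fun r => Real.artanh (r * deriv u r)⁻¹ with hθ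
  have hcs : ∀ r ∈ K 0, Real.sinh (θ r) ≠ 0 ∧
      Real.cosh (θ r) = r * deriv u r * Real.sinh (θ r) := by
    intro r hr
    have h1 : 0 < 1 - (r * deriv u r)⁻¹ ^ 2 := by
      have := (sq_lt_one_iff_abs_lt_one _).2 (abs_lt.2 (hmem r hr))
      linarith
    have h2 := Real.sqrt_pos.2 h1
    rw [hθ]
    simp only [Real.sinh_artanh (hmem r hr), Real.cosh_artanh (hmem r hr)]
    refine ⟨div_ne_zero (inv_ne_zero (hne r hr)) h2.ne', ?_⟩
    rw [← mul_div_assoc, mul_inv_cancel₀ (hne r hr)]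
  have hθs : ContDiffOn ℝ ∞ θ (K 0) := by
    have hu' : ContDiffOn ℝ ∞ (deriv u) (K 0) :=
      ((contDiffOn_infty_iff_deriv_of_isOpen hI).1 h.smooth_u).2
    have h1 : ContDiffOn ℝ ∞ (fun r => (r * deriv u r)⁻¹) (K 0) :=
      (contDiffOn_id.mul hu').inv hne
    have h2 : ∀ r ∈ K 0, 0 < (1 + (r * deriv u r)⁻¹) / (1 - (r * deriv u r)⁻¹) := fun r hr =>
      div_pos (by linarith [(hmem r hr).1]) (by linarith [(hmem r hr).2])
    exact (((contDiffOn_const.add h1).div (contDiffOn_const.sub h1) fun r hr => by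
      linarith [(hmem r hr).2]).sqrt fun r hr => (h2 r hr).ne').log fun r hr =>
        (Real.sqrt_pos.2 (h2 r hr)).ne'
  refine ⟨θ, hθs, fun r hr => ⟨fun h0 => (hcs r hr).1 (by rw [h0, Real.sinh_zero]), ?_⟩, ?_⟩
  · rw [coth, (hcs r hr).2, mul_div_cancel_right₀ _ (hcs r hr).1]
  -- the unit normal for which the decomposition holds
  set ν : E2 → E31 := fun y =>
    -(Real.cosh (θ (y 0)) • (Real.cosh (u (y 0)) • φ (y 1) +
        Real.sinh (u (y 0)) • lorentzCross (φ (y 1)) (deriv φ (y 1))) +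
      Real.sinh (θ (y 0)) • (Real.sinh (u (y 0)) • φ (y 1) +
        Real.cosh (u (y 0)) • lorentzCross (φ (y 1)) (deriv φ (y 1)))) with hν
  have hm0 : Set.MapsTo (fun y : E2 => y 0) U (K 0) := fun y hy => h.coord_mem hy 0
  have hm1 : Set.MapsTo (fun y : E2 => y 1) U (K 1) := fun y hy => h.coord_mem hy 1
  have hνs : ContDiffOn ℝ ∞ ν U := by
    have c0 := (contDiff_coord 0).contDiffOn (s := U)
    have c1 := (contDiff_coord 1).contDiffOn (s := U)
    have hφ := h.curve.smooth.comp c1 hm1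
    have hψ := hφ.lorentzCross ((h.curve.smooth_deriv (h.box.isOpen_side 1)).comp c1 hm1)
    have hu := h.smooth_u.comp c0 hm0
    have ht := hθs.comp c0 hm0
    exact ((ht.cosh.smul ((hu.cosh.smul hφ).add (hu.sinh.smul hψ))).add
      (ht.sinh.smul ((hu.sinh.smul hφ).add (hu.cosh.smul hψ)))).neg
  have hDθ : ∀ y ∈ U, Real.sinh (θ (y 0)) • fderiv ℝ f y (coordVec 0) =
      Real.sinh (θ (y 0)) • (Real.cosh (u (y 0)) • φ (y 1) +
        Real.sinh (u (y 0)) • lorentzCross (φ (y 1)) (deriv φ (y 1))) +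
      Real.cosh (θ (y 0)) • (Real.sinh (u (y 0)) • φ (y 1) +
        Real.cosh (u (y 0)) • lorentzCross (φ (y 1)) (deriv φ (y 1))) := by
    intro y hy
    rw [h.fderiv_zero hy, (hcs _ (h.coord_mem hy 0)).2]
    module
  have hνν : ∀ y ∈ U, mink (ν y) (ν y) = -1 := by
    intro y hy
    obtain ⟨e1, e2, e3, e4, e5, e6, e7⟩ := h.frame hy
    have h1 := Real.cosh_sq_sub_sinh_sq (u (y 0))
    have h2 := Real.cosh_sq_sub_sinh_sq (θ (y 0))
    simp [hν, e1, e5, e6]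
    linear_combination (-(Real.cosh (θ (y 0)) ^ 2) + Real.sinh (θ (y 0)) ^ 2) * h1 - h2
  have hEE : ∀ y ∈ U, mink (Real.sinh (θ (y 0)) • fderiv ℝ f y (coordVec 0))
      (Real.sinh (θ (y 0)) • fderiv ℝ f y (coordVec 0)) = 1 := by
    intro y hy
    have h2 := Real.cosh_sq_sub_sinh_sq (θ (y 0))
    rw [(hcs _ (h.coord_mem hy 0)).2] at h2
    rw [mink_smul_left, mink_smul_right, h.mink_fderiv_zero hy]
    linear_combination h2
  have hνE : ∀ y ∈ U, mink (ν y) (Real.sinh (θ (y 0)) • fderiv ℝ f y (coordVec 0)) = 0 := by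
    intro y hy
    obtain ⟨e1, e2, e3, e4, e5, e6, e7⟩ := h.frame hy
    rw [hDθ y hy]
    simp [hν, e1, e5, e6]
    ring
  have hνφ : ∀ y ∈ U, mink (ν y) (deriv φ (y 1)) = 0 := by
    intro y hy
    obtain ⟨e1, e2, e3, e4, e5, e6, e7⟩ := h.frame hy
    simp [hν, e2, e7]
  -- `n` and `ν` span the same line, and they are unit vectors
  have hn : ∀ y ∈ U, n y = (-mink (n y) (ν y)) • ν y := by
    intro y hy
    obtain ⟨e1, e2, e3, e4, e5, e6, e7⟩ := h.frame hy
    rw [← sub_eq_zero]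
    refine eq_zero_of_mink_frame (a := ν y)
      (b := Real.sinh (θ (y 0)) • fderiv ℝ f y (coordVec 0)) (c := deriv φ (y 1))
      ?_ ?_ ?_ (hνE y hy) (hνφ y hy) ?_ ?_ ?_ ?_
    · rw [hνν y hy]; norm_num
    · rw [hEE y hy]; norm_num
    · rw [e4]; norm_num
    · rw [mink_smul_left, h.mink_fderiv_zero_deriv hy, mul_zero]
    · rw [mink_sub_left, mink_smul_left, hνν y hy]; ring
    · rw [mink_sub_left, mink_smul_left, hνE y hy, mink_smul_right, h.surface.normal y hy]; ring
    · rw [mink_sub_left, mink_smul_left, hνφ y hy, h.mink_normal_deriv hy]; ring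
  have hsq : ∀ y ∈ U, (-mink (n y) (ν y)) ^ 2 = 1 := by
    intro y hy
    have h1 := h.surface.unit y hy
    rw [hn y hy, mink_smul_left, mink_smul_right, hνν y hy] at h1
    linarith
  -- the sign is constant because the box is connected
  have hsign : ∃ ε : ℝ, (ε = 1 ∨ ε = -1) ∧ ∀ y ∈ U, -mink (n y) (ν y) = ε := by
    have hcont : ContinuousOn (fun y => -mink (n y) (ν y)) U :=
      (h.surface.smooth_normal.mink hνs).continuousOn.neg
    rcases h.box.convex.isPreconnected.eq_or_eq_neg_of_sq_eq hcont
      (continuousOn_const (c := (1 : ℝ))) (fun y hy => by simpa using hsq y hy)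
      (fun _ => one_ne_zero) with h1 | h1
    · exact ⟨1, Or.inl rfl, h1⟩
    · exact ⟨-1, Or.inr rfl, h1⟩
  obtain ⟨ε, hε, hεn⟩ := hsign
  refine ⟨ε, hε, fun y hy => ⟨hEE y hy, ?_⟩⟩
  have hε2 : ε * ε = 1 := by rcases hε with rfl | rfl <;> norm_num
  have h2 := Real.cosh_sq_sub_sinh_sq (θ (y 0))
  rw [hn y hy, hεn y hy, smul_smul ε, hε2, one_smul, hDθ y hy, h.eq y hy, hν]
  ext i
  simp
  linear_combination (-(y 0) * (Real.cosh (u (y 0)) * φ (y 1) i +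
    Real.sinh (u (y 0)) * lorentzCross (φ (y 1)) (deriv φ (y 1)) i)) * h2

end IsExplicitGCR

/-! ### From the surface to its coordinate expression -/

section Transfer

variable {M : Type*} [TopologicalSpace M] [ChartedSpace (EuclideanSpace ℝ (Fin 2)) M]

/-- The tangent vector at `q` with given components in the chart `e`, meaningful for `q` in the
source of `e`. The value of `mfderiv` is a tangent vector at `e.symm (e q)`; all tangent spaces are
the same type by definition, which allows it to be read at `q`. -/
noncomputable def chartVec (e : OpenPartialHomeomorph M E2) (q : M) :
    E2 →L[ℝ] TangentSpace (𝓡 2) q :=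
  mfderiv (𝓡 2) (𝓡 2) e.symm (e q)

variable {e : OpenPartialHomeomorph M E2} {x N : M → E31} {q : M}

theorem mdifferentiable_of_mem_maximalAtlas (he : e ∈ IsManifold.maximalAtlas (𝓡 2) ∞ M) :
    e.MDifferentiable (𝓡 2) (𝓡 2) :=
  ⟨(contMDiffOn_of_mem_maximalAtlas he).mdifferentiableOn (by simp),
    (contMDiffOn_symm_of_mem_maximalAtlas he).mdifferentiableOn (by simp)⟩

theorem chartVec_bijective (he : e ∈ IsManifold.maximalAtlas (𝓡 2) ∞ M) (hq : q ∈ e.source) :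
    Function.Bijective (chartVec e q) :=
  (mdifferentiable_of_mem_maximalAtlas he).symm.mfderiv_bijective (e.map_source hq)

theorem surfD_chartVec (he : e ∈ IsManifold.maximalAtlas (𝓡 2) ∞ M) (hq : q ∈ e.source)
    {F : M → E31} (hF : ContMDiff (𝓡 2) 𝓘(ℝ, E31) ∞ F) (v : E2) :
    surfD F q (chartVec e q v) = fderiv ℝ (F ∘ e.symm) (e q) v := by
  have h1 : MDifferentiableAt (𝓡 2) 𝓘(ℝ, E31) F (e.symm (e q)) :=
    (hF.mdifferentiable (by simp)) _
  have h2 := (mdifferentiable_of_mem_maximalAtlas he).mdifferentiableAt_symm (e.map_source hq)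
  have h3 := mfderiv_comp (e q) h1 h2
  rw [mfderiv_eq_fderiv] at h3
  -- moving the base point from `e.symm (e q)` to `q`
  have key : ∀ q', e.symm (e q) = q' → (surfD F q' : E2 →L[ℝ] E31)
      (mfderiv (𝓡 2) (𝓡 2) e.symm (e q) v : E2) = fderiv ℝ (F ∘ e.symm) (e q) v := by
    rintro _ rfl
    exact (congrArg (fun l : E2 →L[ℝ] E31 => l v) h3).symm
  exact key q (e.left_inv hq)

theorem contDiffOn_comp_symm (he : e ∈ IsManifold.maximalAtlas (𝓡 2) ∞ M)
    {F : M → E31} (hF : ContMDiff (𝓡 2) 𝓘(ℝ, E31) ∞ F) :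
    ContDiffOn ℝ ∞ (F ∘ e.symm) e.target :=
  contMDiffOn_iff_contDiffOn.1 (hF.comp_contMDiffOn (contMDiffOn_symm_of_mem_maximalAtlas he))

theorem isLocalSurface_of_chart (hx : IsSpacelikeSurface x) (hN : IsUnitNormal x N)
    (hcone : ∀ p, mink (x p) (x p) < 0) (he : e ∈ IsManifold.maximalAtlas (𝓡 2) ∞ M) :
    IsLocalSurface (x ∘ e.symm) (N ∘ e.symm) e.target where
  isOpen := e.open_target
  smooth := contDiffOn_comp_symm he hx.smooth
  smooth_normal := contDiffOn_comp_symm he hN.smooth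
  spacelike y hy v hv := by
    have hq := e.map_target hy
    have h1 := surfD_chartVec he hq hx.smooth v
    rw [e.right_inv hy] at h1
    rw [← h1]
    refine hx.spacelike _ _ fun h0 => hv ?_
    exact (chartVec_bijective he hq).1 (h0.trans (map_zero _).symm)
  unit y _ := hN.unit _
  normal y hy v := by
    have h1 := surfD_chartVec he (e.map_target hy) hx.smooth v
    rw [e.right_inv hy] at h1
    rw [← h1]
    exact hN.normal _ _
  cone y _ := hcone _

/-- The tangential part of the position vector, computed in a chart. -/
theorem tangentialPart_eq_chartVec (hx : IsSpacelikeSurface x)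
    (he : e ∈ IsManifold.maximalAtlas (𝓡 2) ∞ M) (hq : q ∈ e.source) {v : E2}
    (hv : ∀ z, mink (x q - fderiv ℝ (x ∘ e.symm) (e q) v)
      (fderiv ℝ (x ∘ e.symm) (e q) z) = 0) :
    tangentialPart x q (x q) = chartVec e q v := by
  refine tangentialPart_unique hx q _ _ fun z => ?_
  obtain ⟨z, rfl⟩ := (chartVec_bijective he hq).2 z
  rw [surfD_chartVec he hq hx.smooth, surfD_chartVec he hq hx.smooth]
  exact hv z

/-- The condition on the shape operator, in a chart: a vector is determined by its products with
the normal and with the tangent vectors, so an eigenvector of `S` is one of `-dN`. -/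
theorem isPrincipalDirection_iff (hx : IsSpacelikeSurface x) (hN : IsUnitNormal x N)
    (hcone : ∀ p, mink (x p) (x p) < 0) (he : e ∈ IsManifold.maximalAtlas (𝓡 2) ∞ M)
    (hq : q ∈ e.source) :
    IsPrincipalDirection x N q (tangentialPart x q (x q)) ↔
      IsPrincipalPosition (x ∘ e.symm) (N ∘ e.symm) (e q) := by
  have hloc := isLocalSurface_of_chart hx hN hcone he
  have hy := e.map_source hq
  have hbij := chartVec_bijective he hq
  have hDx := surfD_chartVec he hq hx.smooth
  have hDN := surfD_chartVec he hq hN.smooth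
  have hxq : (x ∘ e.symm) (e q) = x q := by simp [e.left_inv hq]
  constructor
  · rintro ⟨h0, k, hk⟩
    obtain ⟨v, hv⟩ := hbij.2 (tangentialPart x q (x q))
    have hspec := tangentialPart_spec hx q (x q)
    rw [← hv] at h0 hk hspec
    refine ⟨v, fun hv0 => h0 (by rw [hv0, map_zero]), fun z => ?_, -k, ?_⟩
    · rw [hxq, ← hDx, ← hDx]
      exact hspec _
    · have hS : tangentialPart x q (surfD N q (chartVec e q v)) = -(k • chartVec e q v) :=
        neg_eq_iff_eq_neg.1 hk
      have hspec' := tangentialPart_spec hx q (surfD N q (chartVec e q v))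
      rw [hS, map_neg, map_smul, hDx, hDN] at hspec'
      rw [← sub_eq_zero, neg_smul]
      refine hloc.eq_zero_of_perp hy ?_ fun z => ?_
      · rw [mink_sub_left, mink_neg_left, mink_smul_left, mink_comm _ ((N ∘ e.symm) (e q)),
          mink_comm _ ((N ∘ e.symm) (e q)), hloc.normal _ hy, mink_comm,
          mink_fderiv_self hloc.isOpen hy (hloc.differentiableAt_normal hy) hloc.unit]
        simp
      · rw [← hDx z]
        exact hspec' _
  · rintro ⟨v, hv0, hperp, k, hk⟩
    rw [hxq] at hperp
    rw [tangentialPart_eq_chartVec hx he hq hperp]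
    refine ⟨fun h0 => hv0 (hbij.1 (h0.trans (map_zero _).symm)), -k, ?_⟩
    have hS : tangentialPart x q (surfD N q (chartVec e q v)) = k • chartVec e q v := by
      refine tangentialPart_unique hx q _ _ fun z => ?_
      rw [map_smul, hDx, hDN, hk, sub_self, mink_zero_left]
    rw [shapeOperator, hS, neg_smul]

end Transfer

/-! ### The characterization -/

theorem mainTheorem1 {M : Type*} [TopologicalSpace M]
    [ChartedSpace (EuclideanSpace ℝ (Fin 2)) M] [IsManifold (𝓡 2) ∞ M]
    (x N : M → E31) (hx : IsSpacelikeSurface x) (hN : IsUnitNormal x N)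
    (hcone : ∀ p, mink (x p) (x p) < 0) :
    (IsGCR x N ↔
      ∀ p : M, ∃ (e : OpenPartialHomeomorph M (EuclideanSpace ℝ (Fin 2))) (I J : Set ℝ)
        (u : ℝ → ℝ) (φ : ℝ → E31), p ∈ e.source ∧ IsGCRParametrization x e I J u φ) ∧
    (∀ (e : OpenPartialHomeomorph M (EuclideanSpace ℝ (Fin 2))) (I J : Set ℝ)
        (u : ℝ → ℝ) (φ : ℝ → E31), IsGCRParametrization x e I J u φ →
      ∃ ν : M → E31, (ν = N ∨ ν = -N) ∧ HasGCRDecomposition x ν e I u) := by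
  have hexp : ∀ (e : OpenPartialHomeomorph M (EuclideanSpace ℝ (Fin 2))) (I J : Set ℝ)
      (u : ℝ → ℝ) (φ : ℝ → E31), IsGCRParametrization x e I J u φ →
      IsExplicitGCR (x ∘ e.symm) (N ∘ e.symm) e.target ![I, J] u φ := by
    intro e I J u φ h
    refine ⟨isLocalSurface_of_chart hx hN hcone h.chart, ⟨?_, ?_, ?_, ?_⟩, h.smooth_u, h.curve,
      fun y hy => ?_⟩
    · rw [h.target]
      ext y
      simp
    · intro i; fin_cases i; exacts [h.open_I, h.open_J]
    · intro i; fin_cases i; exacts [h.interval_I, h.interval_J]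
    · intro i; fin_cases i; exacts [h.nonempty_I, h.nonempty_J]
    · have := h.eq _ (e.map_target hy)
      rwa [e.right_inv hy] at this
  refine ⟨⟨fun hgcr p => ?_, fun hpar p => ?_⟩, fun e I J u φ h => ?_⟩
  · have hc := IsManifold.chart_mem_maximalAtlas (I := 𝓡 2) (n := ∞) p
    set c := chartAt (EuclideanSpace ℝ (Fin 2)) p with hcdef
    have hp : p ∈ c.source := mem_chart_source _ p
    have hloc := isLocalSurface_of_chart hx hN hcone hc
    have hprin : ∀ y ∈ c.target, IsPrincipalPosition (x ∘ c.symm) (N ∘ c.symm) y := by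
      intro y hy
      have := (isPrincipalDirection_iff hx hN hcone hc (c.map_target hy)).1 (hgcr _)
      rwa [c.right_inv hy] at this
    obtain ⟨g, K, u, φ, hg, hpg, hgU, hu, hφ, heq⟩ :=
      hloc.exists_gcr_chart hprin (c.map_source hp)
    have htarget : (c.trans g).target = g.target := by
      rw [OpenPartialHomeomorph.trans_target]
      refine Set.inter_eq_left.2 fun y hy => hgU (g.map_target hy)
    refine ⟨c.trans g, K 0, K 1, u, φ, ?_, ?_, hg.box.isOpen_side 0, hg.box.ordConnected 0,
      hg.box.nonempty 0, hg.box.isOpen_side 1, hg.box.ordConnected 1, hg.box.nonempty 1, ?_, hu,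
      hφ, fun q hq => ?_⟩
    · rw [OpenPartialHomeomorph.trans_source]
      exact ⟨hp, hpg⟩
    · refine OpenPartialHomeomorph.mem_maximalAtlas_of_contMDiffOn _ ?_ ?_
      · rw [OpenPartialHomeomorph.trans_source]
        exact (contMDiffOn_iff_contDiffOn.2 hg.smooth).comp
          ((contMDiffOn_of_mem_maximalAtlas hc).mono Set.inter_subset_left) fun q hq => hq.2
      · rw [htarget]
        exact (contMDiffOn_symm_of_mem_maximalAtlas hc).comp
          (contMDiffOn_iff_contDiffOn.2 hg.smooth_symm) fun y hy => hgU (g.map_target hy)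
    · rw [htarget, hg.box.eq]
      ext y
      simp
    · rw [OpenPartialHomeomorph.trans_source] at hq
      have := heq _ hq.2
      rwa [Function.comp_apply, c.left_inv hq.1] at this
  · obtain ⟨e, I, J, u, φ, hp, h⟩ := hpar p
    exact (isPrincipalDirection_iff hx hN hcone h.chart hp).2
      ((hexp e I J u φ h).isPrincipalPosition (e.map_source hp))
  · have hE := hexp e I J u φ h
    obtain ⟨θ, hθ, hcoth, ε, hε, hdec⟩ := hE.exists_decomposition
    have hD : ∀ q ∈ e.source, ∀ v, surfD x q (chartVec e q v) =
        fderiv ℝ (x ∘ e.symm) (e q) v := fun q hq v => surfD_chartVec h.chart hq hx.smooth v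
    -- `e₁` is the field `sinh θ ∂_s`, a unit field because `|∂_s x|² = (s u')² - 1 = sinh⁻² θ`
    refine ⟨ε • N, ?_, θ, fun q => chartVec e q (Real.sinh (θ (e q 0)) • coordVec 0), hθ, hcoth,
      ?_, fun q hq => ?_⟩
    · rcases hε with rfl | rfl
      · left; simp
      · right; simp
    · have h1 : ContDiffOn ℝ ∞ (fun y : E2 => Real.sinh (θ (y 0)) •
          fderiv ℝ (x ∘ e.symm) y (coordVec 0)) e.target :=
        ((hθ.comp (contDiff_coord 0).contDiffOn fun y hy => hE.coord_mem hy 0).sinh).smul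
          ((hE.surface.smooth.fderiv_of_isOpen e.open_target (m := ∞) (by simp)).clm_apply
            contDiffOn_const)
      refine ((contMDiffOn_iff_contDiffOn.2 h1).comp (contMDiffOn_of_mem_maximalAtlas h.chart)
        fun q hq => e.map_source hq).congr fun q hq => ?_
      rw [hD q hq, map_smul]
      rfl
    · have hy := e.map_source hq
      obtain ⟨h1, h2⟩ := hdec _ hy
      have hs : Real.sinh (θ (e q 0)) ≠ 0 := fun h0 =>
        (hcoth _ (hE.coord_mem hy 0)).1 (Real.sinh_eq_zero.1 h0)
      rw [hD q hq, map_smul]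
      refine ⟨h1, ?_, ?_⟩
      · have h3 := hE.tangential hy
        rw [Function.comp_apply, e.left_inv hq] at h3
        refine ⟨(-(e q 0) / ((e q 0 * deriv u (e q 0)) ^ 2 - 1)) / Real.sinh (θ (e q 0)), ?_⟩
        rw [tangentialPart_eq_chartVec hx h.chart hq h3, ← map_smul, smul_smul,
          div_mul_cancel₀ _ hs]
      · rw [Function.comp_apply, Function.comp_apply, e.left_inv hq] at h2
        exact h2
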